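/- Let $\mathbb{P}$ be a finite set of proposition symbols and $\mathbb{X}$ a set of variables. The formulas of the graded modal $\mu$-calculus are $$\varphi ::= p \mid \neg p \mid X \mid \varphi\land\varphi \mid \varphi\lor\varphi \mid \Diamond^{\ge k}\varphi \mid \Box^{<k}\varphi \mid \mu X.\varphi \mid \nu X.\varphi \qquad (p\in\mathbb{P},\ X\in\mathbb{X},\ k\ge 1).$$ They are evaluated on finite directed graphs $G=(N,E,g)$ with node labels $g(n)\subseteq\mathbb{P}$, relative to a valuation $V:\mathbb{X}\to 2^N$, giving a set $[\![\varphi]\!]^G_V\subseteq N$. Here $[\![p]\!]^G_V=\{n: p\in g(n)\}$ and $[\![\neg p]\!]^G_V=\{n: p\notin g(n)\}$; $[\![X]\!]^G_V=V(X)$; $\land,\lor$ are intersection and union; $\Diamond^{\ge k}\varphi$ holds at $n$ iff at least $k$ out-neighbours of $n$ satisfy $\varphi$; $\Box^{<k}\varphi$ holds at $n$ iff strictly fewer than $k$ out-neighbours of $n$ do not satisfy $\varphi$; $[\![\mu X.\varphi]\!]^G_V=\bigcap\{S\subseteq N: [\![\varphi]\!]^G_{V[X\mapsto S]}\subseteq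 S\}$ and $[\![\nu X.\varphi]\!]^G_V=\bigcup\{S\subseteq N: S\subseteq[\![\varphi]\!]^G_{V[X\mapsto S]}\}$. A sentence is a formula without free variables; its value $[\![\varphi]\!]^G$ does not depend on $V$. A node classifier $C$ assigns to every such graph $G$ a function $C(G):N\to\{0,1\}$; the sentence $\varphi$ defines $C$ if $[\![\varphi]\!]^G=\{n\in N: C(G)(n)=1\}$ for every $G$. A halting recurrent GNN over a label set $\Lambda$ of dimension $d$ consists of an initialisation function $\mathrm{In}:\Lambda\to\mathbb{R}^d$, a layer $L=(\mathrm{AGG},\mathrm{COMB})$, where for some $h\in\mathbb{N}$ the function $\mathrm{AGG}$ maps finite multisets of vectors in $\mathbb{R}^d$ to $\mathbb{R}^h$ and $\mathrm{COMB}:\mathbb{R}^d\times\mathbb{R}^h\to\mathbb{R}^d$, a halting function $\mathrm{Hlt}:\mathbb{R}^d\to\{0,1\}$ and a readout function $\mathrm{Out}:\mathbb{R}^d\to\{0,1\}$. On a finite $\Lambda$-labeled graph $G=(N,E,g)$ it computes $x_0(n)=\mathrm{In}(g(n))$ and $x_{i+1}(n)=\mathrm{COMB}\big(x_i(n),\mathrm{AGG}\{\!\{x_i(m):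 (n,m)\in E\}\!\}\big)$. Its run on $G$ is complete at $k$ if $k$ is the least index with $\mathrm{Hlt}(x_k(n))=1$ for all $n\in N$; its output is then the labeling $n\mapsto\mathrm{Out}(x_k(n))$. The GNN is totally defined if such a $k$ exists for every finite $\Lambda$-labeled graph $G$; it then defines the node classifier that maps each $G$ to this output. It is simple if $h=d$, $\mathrm{AGG}$ is the sum, $\mathrm{COMB}(x,y)=f(x\mid y)$, where $x\mid y$ is the concatenation and $f=A_\ell\circ\mathrm{ReLU}\circ A_{\ell-1}\circ\cdots\circ\mathrm{ReLU}\circ A_1$ ($\ell\ge1$) for affine maps $A_1,\dots,A_\ell$ between spaces $\mathbb{R}^{p_i}$ (ReLU acting coordinatewise), and each of $\mathrm{Hlt}$ and $\mathrm{Out}$ has the form "$x\mapsto 1$ iff the $i$-th coordinate of $x$ is $>0$" for some fixed $1\le i\le d$. **Theorem.** For every sentence $\varphi$ of the graded modal $\mu$-calculus over $\mathbb{P}$ and every node classifier $C$ defined by $\varphi$, there are $d\in\mathbb{N}$ and a simple halting recurrent GNN over $2^{\mathbb{P}}$ of dimension $d$ that is totally defined and defines $C$. (The GNN does not depend on the input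 graph, in particular not on its size.) -/

import Mathlib

universe u v w

/-- A finite, node-labeled, directed graph with labels in `X`
(loops are allowed and the node set may be empty). -/
structure LabeledGraph (X : Type v) : Type (max (u + 1) v) where
  Node : Type u
  [fintypeNode : Fintype Node]
  Edge : Node → Node → Prop
  label : Node → X

namespace LabeledGraph

attribute [instance] LabeledGraph.fintypeNode

open Classical in
/-- The set of out-neighbours of a node. -/
noncomputable def out {X : Type v} (G : LabeledGraph.{u} X) (n : G.Node) : Finset G.Node :=
  Finset.univ.filter fun m => G.Edge n m

end LabeledGraph

/-- A node classifier on `X`-labeled graphs: a label transformer into Boolean labels. As a label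
transformer keeps nodes and edges, it is given by the new labels alone. -/
abbrev NodeClassifier (X : Type v) : Type (max (u + 1) v) :=
  (G : LabeledGraph.{u} X) → G.Node → Bool

/-- Formulas of the graded modal mu-calculus (in negation normal form) over the proposition
symbols `P` and the variables `Var`. -/
inductive MuFormula (P : Type v) (Var : Type w) : Type (max v w) where
  | prop (p : P)
  | negProp (p : P)
  | var (x : Var)
  | and (φ ψ : MuFormula P Var)
  | or (φ ψ : MuFormula P Var)
  | atLeast (k : ℕ+) (φ : MuFormula P Var)
  | allBut (k : ℕ+) (φ : MuFormula P Var)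
  | mu (x : Var) (φ : MuFormula P Var)
  | nu (x : Var) (φ : MuFormula P Var)

namespace MuFormula

/-- The set of free variables. -/
def free {P : Type v} {Var : Type w} : MuFormula P Var → Set Var
  | prop _ => ∅
  | negProp _ => ∅
  | var x => {x}
  | and φ ψ => φ.free ∪ ψ.free
  | or φ ψ => φ.free ∪ ψ.free
  | atLeast _ φ => φ.free
  | allBut _ φ => φ.free
  | mu x φ => φ.free \ {x}
  | nu x φ => φ.free \ {x}

/-- A sentence is a formula without free variables. -/
def IsSentence {P : Type v} {Var : Type w} (φ : MuFormula P Var) : Prop := φ.free = ∅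

open Classical in
/-- The set of nodes of `G` at which a formula holds under the valuation `V`. -/
noncomputable def sem {P : Type v} {Var : Type w} (G : LabeledGraph.{u} (Set P)) :
    MuFormula P Var → (Var → Set G.Node) → Set G.Node
  | prop p, _ => {n | p ∈ G.label n}
  | negProp p, _ => {n | p ∉ G.label n}
  | var x, V => V x
  | and φ ψ, V => φ.sem G V ∩ ψ.sem G V
  | or φ ψ, V => φ.sem G V ∪ ψ.sem G V
  | atLeast k φ, V => {n | (k : ℕ) ≤ ((G.out n : Set G.Node) ∩ φ.sem G V).ncard}
  | allBut k φ, V => {n | ((G.out n : Set G.Node) \ φ.sem G V).ncard < (k : ℕ)}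
  | mu x φ, V => ⋂₀ {S | φ.sem G (Function.update V x S) ⊆ S}
  | nu x φ, V => ⋃₀ {S | S ⊆ φ.sem G (Function.update V x S)}

open Classical in
theorem sem_congr {P : Type v} {Var : Type w} (G : LabeledGraph.{u} (Set P))
    (φ : MuFormula P Var) :
    ∀ V W : Var → Set G.Node, (∀ x ∈ φ.free, V x = W x) → φ.sem G V = φ.sem G W := by
  have key : ∀ (φ : MuFormula P Var) (x : Var) (V W : Var → Set G.Node) (S : Set G.Node),
      (∀ y ∈ φ.free \ {x}, V y = W y) →
        ∀ y ∈ φ.free, Function.update V x S y = Function.update W x S y := by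
    intro φ x V W S h y hy
    by_cases hyx : y = x
    · subst hyx
      simp
    · simp only [Function.update_of_ne hyx]
      exact h y ⟨hy, hyx⟩
  induction φ with
  | prop p => intro V W _; rfl
  | negProp p => intro V W _; rfl
  | var x => intro V W h; exact h x rfl
  | and φ ψ ih₁ ih₂ =>
    intro V W h
    simp only [sem, ih₁ V W fun x hx => h x (Or.inl hx), ih₂ V W fun x hx => h x (Or.inr hx)]
  | or φ ψ ih₁ ih₂ =>
    intro V W h
    simp only [sem, ih₁ V W fun x hx => h x (Or.inl hx), ih₂ V W fun x hx => h x (Or.inr hx)]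
  | atLeast k φ ih => intro V W h; simp only [sem, ih V W h]
  | allBut k φ ih => intro V W h; simp only [sem, ih V W h]
  | mu x φ ih =>
    intro V W h
    simp only [sem, fun S => ih _ _ (key φ x V W S h)]
  | nu x φ ih =>
    intro V W h
    simp only [sem, fun S => ih _ _ (key φ x V W S h)]

/-- The set of nodes of `G` at which a sentence holds. The valuation used is immaterial, see
`MuFormula.semSentence_eq`. -/
noncomputable def semSentence {P : Type v} {Var : Type w} (φ : MuFormula P Var)
    (G : LabeledGraph.{u} (Set P)) : Set G.Node :=
  φ.sem G fun _ => ∅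

theorem semSentence_eq {P : Type v} {Var : Type w} {φ : MuFormula P Var} (hφ : φ.IsSentence)
    (G : LabeledGraph.{u} (Set P)) (V : Var → Set G.Node) : φ.semSentence G = φ.sem G V :=
  sem_congr G φ _ _ fun x hx => by
    rw [hφ] at hx
    exact hx.elim

/-- `φ` is a sentence that defines the node classifier `C`. -/
def Defines {P : Type v} {Var : Type w} (φ : MuFormula P Var)
    (C : NodeClassifier.{u} (Set P)) : Prop :=
  φ.IsSentence ∧ ∀ G : LabeledGraph.{u} (Set P), φ.semSentence G = {n | C G n = true}

end MuFormula

/-- The rectified linear unit, applied to each coordinate. -/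
noncomputable def reluVec {p : ℕ} (x : Fin p → ℝ) : Fin p → ℝ := fun i => max 0 (x i)

/-- Feedforward networks `A_ℓ ∘ ReLU ∘ A_{ℓ-1} ∘ ⋯ ∘ ReLU ∘ A_1` with affine maps `A_i`, `ℓ ≥ 1`;
`layer A F` applies `A` first, then ReLU, then `F`. -/
inductive ReLUNetwork : ℕ → ℕ → Type where
  | affine {p q : ℕ} (A : (Fin p → ℝ) →ᵃ[ℝ] (Fin q → ℝ)) : ReLUNetwork p q
  | layer {p r q : ℕ} (A : (Fin p → ℝ) →ᵃ[ℝ] (Fin r → ℝ)) (F : ReLUNetwork r q) :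
      ReLUNetwork p q

/-- The function computed by a network. -/
noncomputable def ReLUNetwork.eval : {p q : ℕ} → ReLUNetwork p q → (Fin p → ℝ) → (Fin q → ℝ)
  | _, _, .affine A, x => A x
  | _, _, .layer A F, x => F.eval (reluVec (A x))

/-- Aggregate-combine layers of input dimension `p` and output dimension `q`. -/
structure ACLayer (p q : ℕ) where
  h : ℕ
  agg : Multiset (Fin p → ℝ) → (Fin h → ℝ)
  comb : (Fin p → ℝ) → (Fin h → ℝ) → (Fin q → ℝ)

namespace ACLayer

/-- The feature map that a layer computes from the feature map `g` on the nodes and edges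
of `G`. -/
noncomputable def apply {p q : ℕ} (L : ACLayer p q) {X : Type v} (G : LabeledGraph.{u} X)
    (g : G.Node → (Fin p → ℝ)) : G.Node → (Fin q → ℝ) :=
  fun n => L.comb (g n) (L.agg ((G.out n).val.map g))

/-- A layer is simple if it aggregates by summing and combines by applying a ReLU network to the
concatenation of its two arguments. -/
def IsSimple {p q : ℕ} (L : ACLayer p q) : Prop :=
  ∃ F : ReLUNetwork (p + p) q,
    L = { h := p, agg := Multiset.sum, comb := fun x y => F.eval (Fin.append x y) }

end ACLayer

/-- A function `ℝ^d → {0, 1}` is simple if it tests whether some fixed coordinate is positive. -/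
def IsSimpleTest {d : ℕ} (f : (Fin d → ℝ) → Bool) : Prop :=
  ∃ i : Fin d, ∀ x : Fin d → ℝ, f x = true ↔ 0 < x i

/-- Halting recurrent graph neural networks over `X` of dimension `d`. -/
structure HaltingRecurrentGNN (X : Type v) (d : ℕ) where
  init : X → (Fin d → ℝ)
  layer : ACLayer d d
  hlt : (Fin d → ℝ) → Bool
  readout : (Fin d → ℝ) → Bool

namespace HaltingRecurrentGNN

/-- The feature map after `k` iterations on `G`. -/
noncomputable def run {X : Type v} {d : ℕ} (N : HaltingRecurrentGNN X d)
    (G : LabeledGraph.{u} X) : ℕ → G.Node → (Fin d → ℝ)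
  | 0 => fun n => N.init (G.label n)
  | k + 1 => N.layer.apply G (N.run G k)

/-- The halting function is true at every node after `k` iterations. -/
def AllHalt {X : Type v} {d : ℕ} (N : HaltingRecurrentGNN X d)
    (G : LabeledGraph.{u} X) (k : ℕ) : Prop :=
  ∀ n : G.Node, N.hlt (N.run G k n) = true

/-- The run of `N` on `G` that stops after `k` iterations is complete. -/
def IsComplete {X : Type v} {d : ℕ} (N : HaltingRecurrentGNN X d)
    (G : LabeledGraph.{u} X) (k : ℕ) : Prop :=
  N.AllHalt G k ∧ ∀ j < k, ¬ N.AllHalt G j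

/-- `N` has a complete run on every finite graph. -/
def IsTotallyDefined {X : Type v} {d : ℕ} (N : HaltingRecurrentGNN X d) : Prop :=
  ∀ G : LabeledGraph.{u} X, ∃ k, N.IsComplete G k

/-- `N` is totally defined and the output of its complete run on `G` is `C G`, for every `G`. -/
def Defines {X : Type v} {d : ℕ} (N : HaltingRecurrentGNN X d)
    (C : NodeClassifier.{u} X) : Prop :=
  IsTotallyDefined.{u} N ∧
    ∀ (G : LabeledGraph.{u} X) (k : ℕ), N.IsComplete G k →
      ∀ n : G.Node, N.readout (N.run G k n) = C G n

/-- The layer, the halting function and the readout function are simple. -/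
def IsSimple {X : Type v} {d : ℕ} (N : HaltingRecurrentGNN X d) : Prop :=
  N.layer.IsSimple ∧ IsSimpleTest N.hlt ∧ IsSimpleTest N.readout

end HaltingRecurrentGNN

/-! On a graph with `N` nodes, each fixpoint is reached after at most `N` iterations of its monotone
operator. The network does not know `N`, though, and a node cannot see locally whether an iteration
has stabilised everywhere. So the number of iterations is guessed: phase `k = 0, 1, 2, …` evaluates
the sentence from scratch, iterating every fixpoint `k + 1` times, nested ones anew in each pass of
the outer one. Every node keeps a flag that is lowered when the last pass of some loop changes its
membership, and at the end of the phase it votes for halting iff its flag is still up.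

The quantifier over all nodes in the halting condition is the only global test needed. If all flags
are up, every execution of every loop ended in a stable iterate, so the computed value is the true
one (`MuFormula.exists_reaches_compile`). If `k ≥ N`, all loops stabilise, so some phase succeeds
(`MuFormula.exists_first_halt`). If a node dissents, all nodes move on to the next phase in lockstep
without having to be told.

The phases are programs of a machine whose program counter and numeric counters are common to all
nodes, and one machine step is one layer of the network. States are coded by coordinates in `[0,
1]`: the program counter one-hot, a counter `c` as `2⁻ᶜ`, Boolean registers as `0` or `1`. On these
codes all instructions are piecewise linear, and so is the selection of the current one
(`stateUpdate_encode`); ReLU networks compute all such functions (`ReLUNetwork.exists_eval_eq`). -/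

/-! ### ReLU networks compute piecewise linear functions -/

/-- Functions built from coordinates and constants by addition, scaling and the ReLU. -/
inductive IsPiecewiseLinear {ι : Type} : ((ι → ℝ) → ℝ) → Prop where
  | coord (i : ι) : IsPiecewiseLinear fun x => x i
  | const (c : ℝ) : IsPiecewiseLinear fun _ => c
  | add {f g : (ι → ℝ) → ℝ} : IsPiecewiseLinear f → IsPiecewiseLinear g →
      IsPiecewiseLinear fun x => f x + g x
  | smul (c : ℝ) {f : (ι → ℝ) → ℝ} : IsPiecewiseLinear f → IsPiecewiseLinear fun x => c * f x
  | relu {f : (ι → ℝ) → ℝ} : IsPiecewiseLinear f → IsPiecewiseLinear fun x => max 0 (f x)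

namespace IsPiecewiseLinear

variable {ι : Type}

theorem sub {f g : (ι → ℝ) → ℝ} (hf : IsPiecewiseLinear f) (hg : IsPiecewiseLinear g) :
    IsPiecewiseLinear fun x => f x - g x := by
  have h := hf.add (hg.smul (-1))
  have e : (fun x => f x + -1 * g x) = fun x => f x - g x := by
    funext x
    ring
  rwa [e] at h

theorem sum {κ : Type*} (s : Finset κ) {f : κ → (ι → ℝ) → ℝ}
    (hf : ∀ k, IsPiecewiseLinear (f k)) : IsPiecewiseLinear fun x => ∑ k ∈ s, f k x := by
  classical
  induction s using Finset.induction_on with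
  | empty => simpa using const 0
  | insert a s ha ih => simpa [Finset.sum_insert ha] using (hf a).add ih

end IsPiecewiseLinear

namespace ReLUNetwork

/-- Serial composition of networks. -/
def comp {q r : ℕ} (F' : ReLUNetwork q r) : {p : ℕ} → ReLUNetwork p q → ReLUNetwork p r
  | _, .layer A F => .layer A (comp F' F)
  | _, .affine A => match F' with
    | .affine B => .affine (B.comp A)
    | .layer B F => .layer (B.comp A) F

theorem eval_comp {p q r : ℕ} (F' : ReLUNetwork q r) (F : ReLUNetwork p q) (x : Fin p → ℝ) :
    (F'.comp F).eval x = F'.eval (F.eval x) := by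
  induction F with
  | affine A => cases F' <;> simp [comp, eval]
  | layer A F ih => simp [comp, eval, ih]

theorem exists_eval_linear {p q : ℕ} (A : (Fin p → ℝ) →ₗ[ℝ] (Fin q → ℝ)) :
    ∃ F : ReLUNetwork p q, ∀ x, F.eval x = A x :=
  ⟨.affine A.toAffineMap, fun _ => rfl⟩

/-- The identity survives a ReLU layer because `x = max 0 x - max 0 (-x)`. Hence the hidden layer
carries the negatives of the first `n` coordinates in addition to all coordinates. -/
theorem exists_eval_relu_last (n : ℕ) : ∃ F : ReLUNetwork (n + 1) (n + 1),
    ∀ (x : Fin n → ℝ) (a : ℝ), F.eval (Fin.snoc x a : Fin (n + 1) → ℝ) =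
      (Fin.snoc x (max 0 a) : Fin (n + 1) → ℝ) := by
  let A : (Fin (n + 1) → ℝ) →ₗ[ℝ] (Fin ((n + 1) + n) → ℝ) :=
    LinearMap.pi (Fin.append (α := (Fin (n + 1) → ℝ) →ₗ[ℝ] ℝ)
      (fun i => (LinearMap.proj i : (Fin (n + 1) → ℝ) →ₗ[ℝ] ℝ))
      fun i => -(LinearMap.proj i.castSucc : (Fin (n + 1) → ℝ) →ₗ[ℝ] ℝ))
  let B : (Fin ((n + 1) + n) → ℝ) →ₗ[ℝ] (Fin (n + 1) → ℝ) :=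
    LinearMap.pi (Fin.snoc (α := fun _ => (Fin ((n + 1) + n) → ℝ) →ₗ[ℝ] ℝ)
      (fun i => (LinearMap.proj (Fin.castAdd n i.castSucc) : (Fin ((n + 1) + n) → ℝ) →ₗ[ℝ] ℝ) -
        LinearMap.proj (Fin.natAdd (n + 1) i))
      (LinearMap.proj (Fin.castAdd n (Fin.last n))))
  refine ⟨.layer A.toAffineMap (.affine B.toAffineMap), fun x a => ?_⟩
  funext i
  refine Fin.lastCases ?_ (fun i => ?_) i
  · simp [eval, A, B, reluVec]
  · simp only [eval, A, B, reluVec, LinearMap.coe_toAffineMap, LinearMap.pi_apply,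
      Fin.snoc_castSucc, LinearMap.sub_apply, LinearMap.proj_apply, Fin.append_left,
      Fin.append_right, LinearMap.neg_apply]
    rcases le_total 0 (x i) with h | h <;> simp [h]

/-- Networks are built like straight-line programs: each keeps its input and appends one result. The
map `e` locates the arguments of `f` in a possibly longer vector; for a sum, the second summand is
computed after the first one has been appended. -/
theorem exists_eval_snoc {p : ℕ} {f : (Fin p → ℝ) → ℝ} (hf : IsPiecewiseLinear f) :
    ∀ {n : ℕ} (e : Fin p → Fin n), ∃ F : ReLUNetwork n (n + 1),
      ∀ x, F.eval x = (Fin.snoc x (f fun i => x (e i)) : Fin (n + 1) → ℝ) := by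
  induction hf with
  | coord i =>
    intro n e
    obtain ⟨F, hF⟩ := exists_eval_linear (LinearMap.pi (Fin.snoc
      (α := fun _ => (Fin n → ℝ) →ₗ[ℝ] ℝ) (fun j => LinearMap.proj j) (LinearMap.proj (e i))))
    refine ⟨F, fun x => ?_⟩
    rw [hF]
    funext j
    refine Fin.lastCases ?_ (fun j => ?_) j <;> simp
  | const c =>
    intro n e
    let A : (Fin n → ℝ) →ₗ[ℝ] (Fin (n + 1) → ℝ) := LinearMap.pi (Fin.snoc
      (α := fun _ => (Fin n → ℝ) →ₗ[ℝ] ℝ) (fun j => LinearMap.proj j) 0)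
    refine ⟨.affine (A.toAffineMap + AffineMap.const ℝ (Fin n → ℝ)
      (Pi.single (Fin.last n) c : Fin (n + 1) → ℝ)), fun x => ?_⟩
    funext j
    refine Fin.lastCases ?_ (fun j => ?_) j <;> simp [eval, A, (Fin.castSucc_lt_last _).ne]
  | add _ _ ihf ihg =>
    intro n e
    obtain ⟨F₁, h₁⟩ := ihf e
    obtain ⟨F₂, h₂⟩ := ihg fun i => (e i).castSucc
    obtain ⟨F₃, h₃⟩ := exists_eval_linear (p := n + 1 + 1) (LinearMap.pi (Fin.snoc
      (α := fun _ => (Fin (n + 1 + 1) → ℝ) →ₗ[ℝ] ℝ)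
      (fun j : Fin n => LinearMap.proj j.castSucc.castSucc)
      ((LinearMap.proj (Fin.last n).castSucc : (Fin (n + 1 + 1) → ℝ) →ₗ[ℝ] ℝ) +
        LinearMap.proj (Fin.last (n + 1)))))
    refine ⟨F₃.comp (F₂.comp F₁), fun x => ?_⟩
    rw [eval_comp, eval_comp, h₁, h₂, h₃]
    funext j
    refine Fin.lastCases ?_ (fun j => ?_) j <;> simp
  | smul c _ ih =>
    intro n e
    obtain ⟨F₁, h₁⟩ := ih e
    obtain ⟨F₂, h₂⟩ := exists_eval_linear (p := n + 1) (LinearMap.pi (Fin.snoc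
      (α := fun _ => (Fin (n + 1) → ℝ) →ₗ[ℝ] ℝ)
      (fun j : Fin n => LinearMap.proj j.castSucc) (c • LinearMap.proj (Fin.last n))))
    refine ⟨F₂.comp F₁, fun x => ?_⟩
    rw [eval_comp, h₁, h₂]
    funext j
    refine Fin.lastCases ?_ (fun j => ?_) j <;> simp
  | relu _ ih =>
    intro n e
    obtain ⟨F₁, h₁⟩ := ih e
    obtain ⟨F₂, h₂⟩ := exists_eval_relu_last n
    exact ⟨F₂.comp F₁, fun x => by rw [eval_comp, h₁, h₂]⟩

theorem exists_eval_append {p q : ℕ} (f : Fin q → (Fin p → ℝ) → ℝ)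
    (hf : ∀ j, IsPiecewiseLinear (f j)) :
    ∃ F : ReLUNetwork p (p + q), ∀ x, F.eval x = Fin.append x fun j => f j x := by
  induction q with
  | zero =>
    obtain ⟨F, hF⟩ := exists_eval_linear (LinearMap.id : (Fin p → ℝ) →ₗ[ℝ] _)
    refine ⟨F, fun x => (hF x).trans ?_⟩
    funext i
    exact (Fin.append_left x _ i).symm
  | succ q ih =>
    obtain ⟨F₁, h₁⟩ := ih (fun j => f j.castSucc) fun j => hf _
    obtain ⟨F₂, h₂⟩ := exists_eval_snoc (hf (Fin.last q)) (Fin.castAdd q)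
    refine ⟨F₂.comp F₁, fun x => ?_⟩
    rw [eval_comp, h₁, h₂]
    simp only [Fin.append_left]
    rw [← Fin.append_snoc]
    congr 1
    funext j
    refine Fin.lastCases ?_ (fun j => ?_) j <;> simp

/-- Every vector of piecewise linear functions is computed by a network. -/
theorem exists_eval_eq {p q : ℕ} (f : Fin q → (Fin p → ℝ) → ℝ)
    (hf : ∀ j, IsPiecewiseLinear (f j)) :
    ∃ F : ReLUNetwork p q, ∀ x j, F.eval x j = f j x := by
  obtain ⟨F₁, h₁⟩ := exists_eval_append f hf
  obtain ⟨F₂, h₂⟩ := exists_eval_linear (LinearMap.funLeft ℝ ℝ (Fin.natAdd (m := q) p))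
  exact ⟨F₂.comp F₁, fun x j => by rw [eval_comp, h₁, h₂]; simp [LinearMap.funLeft]⟩

end ReLUNetwork

/-! ### Monotonicity and finite fixpoint iteration -/

theorem MuFormula.sem_mono {P : Type v} {Var : Type w} (G : LabeledGraph.{u} (Set P))
    (φ : MuFormula P Var) : Monotone (φ.sem G) := by
  classical
  have up : ∀ (x : Var) (V W : Var → Set G.Node) (S : Set G.Node), V ≤ W →
      Function.update V x S ≤ Function.update W x S := by
    intro x V W S h y
    by_cases hy : y = x
    · subst hy
      simp
    · simpa [Function.update_of_ne hy] using h y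
  induction φ with
  | prop p => intro V W _; exact le_rfl
  | negProp p => intro V W _; exact le_rfl
  | var x => intro V W h; exact h x
  | and φ ψ ih₁ ih₂ => intro V W h; exact Set.inter_subset_inter (ih₁ h) (ih₂ h)
  | or φ ψ ih₁ ih₂ => intro V W h; exact Set.union_subset_union (ih₁ h) (ih₂ h)
  | atLeast k φ ih =>
    intro V W h n hn
    exact le_trans (show (k : ℕ) ≤ _ from hn)
      (Set.ncard_le_ncard (Set.inter_subset_inter_right _ (ih h)) (Set.toFinite _))
  | allBut k φ ih =>
    intro V W h n hn
    exact lt_of_le_of_lt (Set.ncard_le_ncard (Set.sdiff_subset_sdiff_right (ih h))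
      (Set.toFinite _)) (show _ < (k : ℕ) from hn)
  | mu x φ ih =>
    intro V W h n hn S hS
    refine hn S ?_
    have e : (Function.update V x S) ≤ Function.update W x S := by
      convert up x V W S h
    exact (ih e).trans hS
  | nu x φ ih =>
    rintro V W h n ⟨S, hS, hn⟩
    refine ⟨S, ?_, hn⟩
    have e : (Function.update V x S) ≤ Function.update W x S := by
      convert up x V W S h
    exact Set.Subset.trans hS (ih e)

section Iteration

/-- The iterates of `⊥` increase, and each strict increase costs at least one unit of rank, of which
only `k` are available. Applied to the order dual, this also covers greatest fixpoints. -/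
theorem iterate_bot_eq_succ {α : Type*} [PartialOrder α] [OrderBot α] {F : α → α}
    (hF : Monotone F) {rank : α → ℕ} (hr : StrictMono rank) {k : ℕ} (hk : ∀ a, rank a ≤ k) :
    F^[k] ⊥ = F^[k + 1] ⊥ := by
  have mono : ∀ i, F^[i] ⊥ ≤ F^[i + 1] ⊥ := by
    intro i
    rw [Function.iterate_succ_apply]
    exact hF.iterate i bot_le
  have key : ∀ i, F^[i] ⊥ = F^[i + 1] ⊥ ∨ i + 1 ≤ rank (F^[i + 1] ⊥) := by
    intro i
    induction i with
    | zero =>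
      rcases (mono 0).eq_or_lt with h | h
      · exact Or.inl h
      · exact Or.inr (by have := hr h; omega)
    | succ i ih =>
      rcases ih with ih | ih
      · left
        rw [Function.iterate_succ_apply' F (i + 1), Function.iterate_succ_apply' F i] at *
        rw [← ih]
        exact ih
      · rcases (mono (i + 1)).eq_or_lt with h | h
        · exact Or.inl h
        · exact Or.inr (by have := hr h; omega)
  rcases key k with h | h
  · exact h
  · have := hk (F^[k + 1] ⊥)
    omega

theorem iterate_empty_eq_succ {α : Type*} [Fintype α] {F : Set α → Set α} (hF : Monotone F)
    {k : ℕ} (hk : Fintype.card α ≤ k) : F^[k] ∅ = F^[k + 1] ∅ :=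
  iterate_bot_eq_succ hF (rank := Set.ncard)
    (fun _ t h => Set.ncard_lt_ncard h (Set.toFinite t))
    fun s => (Set.ncard_le_card s).trans (by rwa [Nat.card_eq_fintype_card])

theorem iterate_univ_eq_succ {α : Type*} [Fintype α] {F : Set α → Set α} (hF : Monotone F)
    {k : ℕ} (hk : Fintype.card α ≤ k) : F^[k] Set.univ = F^[k + 1] Set.univ :=
  iterate_bot_eq_succ (α := (Set α)ᵒᵈ) hF.dual
    (rank := fun s => (OrderDual.ofDual s)ᶜ.ncard)
    (fun _ _ h => Set.ncard_lt_ncard (compl_lt_compl_iff_lt.2 h) (Set.toFinite _))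
    fun s => (Set.ncard_le_card _).trans (by rwa [Nat.card_eq_fintype_card])

/-- A stable iterate is itself a prefixed point, and all iterates of `∅` lie below every prefixed
point. Only stability matters, not a bound on `k`, so early phases may already be correct. -/
theorem sInter_eq_iterate {α : Type*} {F : Set α → Set α} (hF : Monotone F) {k : ℕ}
    (h : F^[k] ∅ = F^[k + 1] ∅) : ⋂₀ {S | F S ⊆ S} = F^[k] ∅ := by
  apply Set.Subset.antisymm
  · apply Set.sInter_subset_of_mem
    rw [Set.mem_ofPred_eq, ← Function.iterate_succ_apply' F, ← h]
  · refine Set.subset_sInter fun S hS => ?_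
    have : ∀ i, F^[i] ∅ ⊆ S := by
      intro i
      induction i with
      | zero => exact Set.empty_subset S
      | succ i ih =>
        rw [Function.iterate_succ_apply']
        exact (hF ih).trans hS
    exact this k

theorem sUnion_eq_iterate {α : Type*} {F : Set α → Set α} (hF : Monotone F) {k : ℕ}
    (h : F^[k] Set.univ = F^[k + 1] Set.univ) : ⋃₀ {S | S ⊆ F S} = F^[k] Set.univ := by
  apply Set.Subset.antisymm
  · refine Set.sUnion_subset fun S hS => ?_
    have : ∀ i, S ⊆ F^[i] Set.univ := by
      intro i
      induction i with
      | zero => exact Set.subset_univ S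
      | succ i ih =>
        rw [Function.iterate_succ_apply']
        exact Set.Subset.trans hS (hF ih)
    exact this k
  · apply Set.subset_sUnion_of_mem
    rw [Set.mem_ofPred_eq, ← Function.iterate_succ_apply' F, ← h]

end Iteration

/-! ### The lockstep machine -/

/-- Instructions of a machine that runs in lockstep on all nodes of a graph. The program counter
and the numeric counters are common to all nodes, the Boolean registers are local. -/
inductive Instr where
  | op (dst a b : ℕ) (f : Bool → Bool → Bool)
  | count (dst a k : ℕ)
  | load (c : ℕ)
  | loop (c back : ℕ)
  | restart

/-- Global states of the machine. -/
structure Config (N : Type u) where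
  pc : ℕ
  cnt : ℕ → ℕ
  reg : ℕ → Set N

section Machine

variable {X : Type v} (G : LabeledGraph.{u} X)

open Classical in
/-- The effect of one instruction. Counter `0` holds the number of the current phase. -/
noncomputable def Instr.exec : Instr → Config G.Node → Config G.Node
  | op dst a b f, s => ⟨s.pc + 1, s.cnt, Function.update s.reg dst
      {n | f (decide (n ∈ s.reg a)) (decide (n ∈ s.reg b)) = true}⟩
  | count dst a k, s => ⟨s.pc + 1, s.cnt, Function.update s.reg dst
      {n | k ≤ ((G.out n).filter (· ∈ s.reg a)).card}⟩
  | load c, s => ⟨s.pc + 1, Function.update s.cnt c (s.cnt 0), s.reg⟩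
  | loop c back, s => if s.cnt c = 0 then ⟨s.pc + 1, s.cnt, s.reg⟩ else
      ⟨s.pc - back, Function.update s.cnt c (s.cnt c - 1), s.reg⟩
  | restart, s => ⟨0, Function.update s.cnt 0 (s.cnt 0 + 1), s.reg⟩

/-- One step of the machine; running out of the program starts the next phase. -/
noncomputable def machineStep (Q : List Instr) (s : Config G.Node) : Config G.Node :=
  (Q.getD s.pc .restart).exec G s

/-- `s` evolves into `s'` with register `1` unchanged all along. -/
def Reaches (Q : List Instr) (s s' : Config G.Node) : Prop :=
  ∃ n, (machineStep G Q)^[n] s = s' ∧ ∀ i ≤ n, ((machineStep G Q)^[i] s).reg 1 = s.reg 1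

/-- `C` is the part of `Q` that begins at position `a`. -/
def CodeAt (Q : List Instr) (a : ℕ) (C : List Instr) : Prop :=
  ∃ Q₁ Q₂, Q = Q₁ ++ C ++ Q₂ ∧ Q₁.length = a

theorem CodeAt.left {Q : List Instr} {a : ℕ} {C D : List Instr} (h : CodeAt Q a (C ++ D)) :
    CodeAt Q a C := by
  obtain ⟨Q₁, Q₂, rfl, rfl⟩ := h
  exact ⟨Q₁, D ++ Q₂, by simp, rfl⟩

theorem CodeAt.right {Q : List Instr} {a : ℕ} {C D : List Instr} (h : CodeAt Q a (C ++ D)) :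
    CodeAt Q (a + C.length) D := by
  obtain ⟨Q₁, Q₂, rfl, rfl⟩ := h
  exact ⟨Q₁ ++ C, Q₂, by simp, by simp⟩

theorem CodeAt.tail {Q : List Instr} {a : ℕ} {i : Instr} {C : List Instr}
    (h : CodeAt Q a (i :: C)) : CodeAt Q (a + 1) C :=
  CodeAt.right (C := [i]) h

theorem CodeAt.step_eq {Q : List Instr} {i : Instr} {C : List Instr} {s : Config G.Node}
    (h : CodeAt Q s.pc (i :: C)) : machineStep G Q s = i.exec G s := by
  obtain ⟨Q₁, Q₂, rfl, h⟩ := h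
  simp [machineStep, ← h]

variable {G} {Q : List Instr}

theorem Reaches.reg_one {s t : Config G.Node} (h : Reaches G Q s t) : t.reg 1 = s.reg 1 := by
  obtain ⟨n, rfl, h⟩ := h
  exact h n le_rfl

theorem Reaches.trans {s t r : Config G.Node} (h₁ : Reaches G Q s t) (h₂ : Reaches G Q t r) :
    Reaches G Q s r := by
  have h := h₁.reg_one
  obtain ⟨n, rfl, h₁⟩ := h₁
  obtain ⟨m, rfl, h₂⟩ := h₂
  refine ⟨m + n, Function.iterate_add_apply _ _ _ _, fun i hi => ?_⟩
  rcases le_total i n with hin | hin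
  · exact h₁ i hin
  · obtain ⟨j, rfl⟩ := Nat.exists_eq_add_of_le' hin
    rw [Function.iterate_add_apply, h₂ j (by omega), h]

theorem Reaches.step {s t : Config G.Node} {i : Instr} {C : List Instr}
    (h : CodeAt Q s.pc (i :: C)) (ht : i.exec G s = t) (h1 : t.reg 1 = s.reg 1) :
    Reaches G Q s t := by
  refine ⟨1, by rw [Function.iterate_one, h.step_eq, ht], fun i hi => ?_⟩
  rcases Nat.le_one_iff_eq_zero_or_eq_one.1 hi with rfl | rfl
  · rfl
  · rw [Function.iterate_one, h.step_eq, ht, h1]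

end Machine

/-! ### Compiling formulas into machine code -/

open Classical in
/-- Code that puts the value of a formula into register `r`. The variable `x` is read from register
`ρ x`, the proposition `p` from register `π p`. Registers and counters above `r` are overwritten.
Fixpoints are iterated once more than counter `0` says, and register `0` is cleared at the nodes
that see the last iteration change something. -/
noncomputable def MuFormula.compile {P : Type v} {Var : Type w} (π : P → ℕ) :
    MuFormula P Var → (Var → ℕ) → ℕ → List Instr
  | prop p, _, r => [.op r (π p) (π p) fun a _ => a]
  | negProp p, _, r => [.op r (π p) (π p) fun a _ => !a]
  | var x, ρ, r => [.op r (ρ x) (ρ x) fun a _ => a]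
  | and φ ψ, ρ, r => φ.compile π ρ r ++ (ψ.compile π ρ (r + 1) ++
      [.op r r (r + 1) fun a b => a && b])
  | or φ ψ, ρ, r => φ.compile π ρ r ++ (ψ.compile π ρ (r + 1) ++
      [.op r r (r + 1) fun a b => a || b])
  | atLeast k φ, ρ, r => φ.compile π ρ r ++ [.count r r k]
  | allBut k φ, ρ, r => φ.compile π ρ r ++
      [.op r r r fun a _ => !a, .count r r k, .op r r r fun a _ => !a]
  | mu x φ, ρ, r => fixCode r false (φ.compile π (Function.update ρ x r) (r + 1))
  | nu x φ, ρ, r => fixCode r true (φ.compile π (Function.update ρ x r) (r + 1))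
where
  /-- Code that iterates `body`, which maps register `r` to register `r + 1`. -/
  fixCode (r : ℕ) (start : Bool) (body : List Instr) : List Instr :=
    .op r r r (fun _ _ => start) :: .load r :: (body ++
      [.op (r + 2) r (r + 1) fun a b => a == b, .op r (r + 1) (r + 1) fun a _ => a,
        .loop r (body.length + 2), .op 0 0 (r + 2) fun a b => a && b])

section Correctness

variable {X : Type v} {G : LabeledGraph.{u} X} {Q : List Instr}

open Classical in
theorem exists_reaches_op {s : Config G.Node} {dst a b : ℕ} {f : Bool → Bool → Bool}
    {C : List Instr} (h : CodeAt Q s.pc (.op dst a b f :: C)) (h1 : dst ≠ 1) :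
    ∃ s', Reaches G Q s s' ∧ s'.pc = s.pc + 1 ∧ s'.cnt = s.cnt ∧
      s'.reg dst = {n | f (decide (n ∈ s.reg a)) (decide (n ∈ s.reg b)) = true} ∧
      ∀ i, i ≠ dst → s'.reg i = s.reg i :=
  ⟨_, .step h rfl (Function.update_of_ne h1.symm _ _), rfl, rfl, Function.update_self .., fun _ hi =>
    Function.update_of_ne hi _ _⟩

open Classical in
theorem exists_reaches_count {s : Config G.Node} {dst a k : ℕ}
    {C : List Instr} (h : CodeAt Q s.pc (.count dst a k :: C)) (h1 : dst ≠ 1) :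
    ∃ s', Reaches G Q s s' ∧ s'.pc = s.pc + 1 ∧ s'.cnt = s.cnt ∧
      s'.reg dst = {n | k ≤ ((G.out n).filter (· ∈ s.reg a)).card} ∧
      ∀ i, i ≠ dst → s'.reg i = s.reg i :=
  ⟨_, .step h rfl (Function.update_of_ne h1.symm _ _), rfl, rfl, Function.update_self .., fun _ hi =>
    Function.update_of_ne hi _ _⟩

theorem exists_reaches_load {s : Config G.Node} {c : ℕ} {C : List Instr}
    (h : CodeAt Q s.pc (.load c :: C)) :
    ∃ s', Reaches G Q s s' ∧ s'.pc = s.pc + 1 ∧ s'.cnt c = s.cnt 0 ∧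
      (∀ i, i ≠ c → s'.cnt i = s.cnt i) ∧ s'.reg = s.reg :=
  ⟨_, .step h rfl rfl, rfl, Function.update_self .., fun _ hi => Function.update_of_ne hi _ _, rfl⟩

theorem exists_reaches_loop_zero {s : Config G.Node} {c back : ℕ} {C : List Instr}
    (h : CodeAt Q s.pc (.loop c back :: C)) (hc : s.cnt c = 0) :
    ∃ s', Reaches G Q s s' ∧ s'.pc = s.pc + 1 ∧ s'.cnt = s.cnt ∧ s'.reg = s.reg :=
  ⟨⟨s.pc + 1, s.cnt, s.reg⟩, .step h (by simp [Instr.exec, hc]) rfl, rfl, rfl, rfl⟩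

theorem exists_reaches_loop_succ {s : Config G.Node} {c back k : ℕ} {C : List Instr}
    (h : CodeAt Q s.pc (.loop c back :: C)) (hc : s.cnt c = k + 1) :
    ∃ s', Reaches G Q s s' ∧ s'.pc = s.pc - back ∧ s'.cnt c = k ∧
      (∀ i, i ≠ c → s'.cnt i = s.cnt i) ∧ s'.reg = s.reg :=
  ⟨⟨s.pc - back, Function.update s.cnt c k, s.reg⟩, .step h (by simp [Instr.exec, hc]) rfl, rfl,
    by simp, fun _ hi => Function.update_of_ne hi _ _, rfl⟩

/-- From `s` to `s'`, only registers `0` and `≥ r` have changed, register `0` has not grown, and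
`p` holds if it is still full; both `p` and the equality of the registers `0` are guaranteed in
late phases. -/
structure Config.Advances (r : ℕ) (s s' : Config G.Node) (p : Prop) : Prop where
  cnt : ∀ i < r, s'.cnt i = s.cnt i
  reg : ∀ i < r, 0 < i → s'.reg i = s.reg i
  ok_subset : s'.reg 0 ⊆ s.reg 0
  ok_eq : Fintype.card G.Node ≤ s.cnt 0 → s'.reg 0 = s.reg 0
  out : s'.reg 0 = Set.univ ∨ Fintype.card G.Node ≤ s.cnt 0 → p

theorem Config.Advances.of_out {r : ℕ} {s t t' : Config G.Node} {p q : Prop}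
    (h : s.Advances r t p) (hc : ∀ i < r, t'.cnt i = t.cnt i) (hr : ∀ i < r, t'.reg i = t.reg i)
    (h0 : 0 < r) (hpq : p → q) : s.Advances r t' q where
  cnt i hi := (hc i hi).trans (h.cnt i hi)
  reg i hi hi' := (hr i hi).trans (h.reg i hi hi')
  ok_subset := hr 0 h0 ▸ h.ok_subset
  ok_eq hk := (hr 0 h0).trans (h.ok_eq hk)
  out ho := hpq (h.out (hr 0 h0 ▸ ho))

/-- Register `0` only shrinks, so if it is full at the end then it was full at the intermediate
state, and both guarantees apply. -/
theorem Config.Advances.trans {r : ℕ} {s t t' : Config G.Node} {p q : Prop}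
    (h : s.Advances r t p) (h' : t.Advances r t' q) (h0 : 0 < r) : s.Advances r t' (p ∧ q) where
  cnt i hi := (h'.cnt i hi).trans (h.cnt i hi)
  reg i hi hi' := (h'.reg i hi hi').trans (h.reg i hi hi')
  ok_subset := h'.ok_subset.trans h.ok_subset
  ok_eq hk := (h'.ok_eq (by rwa [h.cnt 0 h0])).trans (h.ok_eq hk)
  out ho := by
    refine ⟨h.out (ho.imp_left fun hu => Set.univ_subset_iff.1 ?_), h'.out ?_⟩
    · rw [← hu]
      exact h'.ok_subset
    · rwa [h.cnt 0 h0]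

theorem Config.Advances.mono {r r' : ℕ} {s t : Config G.Node} {p : Prop}
    (h : s.Advances r t p) (hr : r' ≤ r) : s.Advances r' t p :=
  ⟨fun i hi => h.cnt i (by omega), fun i hi => h.reg i (by omega), h.ok_subset, h.ok_eq, h.out⟩

theorem Config.Advances.imp {r : ℕ} {s t : Config G.Node} {p q : Prop}
    (h : s.Advances r t p) (hpq : p → q) : s.Advances r t q :=
  ⟨h.cnt, h.reg, h.ok_subset, h.ok_eq, fun ho => hpq (h.out ho)⟩

/-- The counter is tested after the body, so the value `c` yields `c + 1` passes. Register `r + 2`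
is overwritten in each pass and finally compares the last two iterates. The body is known to compute
`F` only conditionally, because inner fixpoints may fail to stabilise; register `0` may change and
is therefore left out of the invariant. -/
theorem exists_reaches_loop {r : ℕ} (hr : 2 ≤ r) {body C : List Instr} {a : ℕ} (s₀ : Config G.Node)
    (F : Set G.Node → Set G.Node)
    (hbody : ∀ s : Config G.Node, s.pc = a → (∀ i < r, 0 < i → s.reg i = s₀.reg i) →
      ∃ s', Reaches G Q s s' ∧ s'.pc = a + body.length ∧
        s.Advances (r + 1) s' (s'.reg (r + 1) = F (s.reg r)))
    (hQ : CodeAt Q a (body ++ (.op (r + 2) r (r + 1) (fun a b => a == b) ::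
      .op r (r + 1) (r + 1) (fun a _ => a) :: .loop r (body.length + 2) :: C))) (c : ℕ) :
    ∀ s : Config G.Node, s.pc = a → (∀ i < r, 0 < i → s.reg i = s₀.reg i) → s.cnt r = c →
      ∃ s', Reaches G Q s s' ∧ s'.pc = a + body.length + 3 ∧
        s.Advances r s' (s'.reg r = F^[c + 1] (s.reg r) ∧
          s'.reg (r + 2) = {n | n ∈ F^[c] (s.reg r) ↔ n ∈ F^[c + 1] (s.reg r)}) := by
  have hQ1 := hQ.right
  have hQ2 := hQ1.tail
  have hQ3 := hQ2.tail
  have once : ∀ s : Config G.Node, s.pc = a → (∀ i < r, 0 < i → s.reg i = s₀.reg i) →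
      ∃ s', Reaches G Q s s' ∧ s'.pc = a + body.length + 2 ∧ s'.cnt r = s.cnt r ∧
        s.Advances r s' (s'.reg r = F (s.reg r) ∧
          s'.reg (r + 2) = {n | n ∈ s.reg r ↔ n ∈ F (s.reg r)}) := by
    intro s hs hreg
    obtain ⟨s₁, h₁, hp₁, ha₁⟩ := hbody s hs hreg
    obtain ⟨s₂, h₂, hp₂, hc₂, hd₂, hr₂⟩ := exists_reaches_op (hp₁ ▸ hQ1) (by omega)
    have hp₂' : s₂.pc = a + body.length + 1 := by omega
    obtain ⟨s₃, h₃, hp₃, hc₃, hd₃, hr₃⟩ := exists_reaches_op (hp₂' ▸ hQ2) (by omega)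
    refine ⟨s₃, (h₁.trans h₂).trans h₃, by omega, by rw [hc₃, hc₂, ha₁.cnt r (by omega)],
      (ha₁.mono (by omega)).of_out (fun i hi => by rw [hc₃, hc₂]) (fun i hi => ?_) (by omega)
        fun h => ⟨?_, ?_⟩⟩
    · rw [hr₃ i (by omega), hr₂ i (by omega)]
    · rw [hd₃, ← h, hr₂ (r + 1) (by omega)]
      ext n
      simp
    · rw [hr₃ (r + 2) (by omega), hd₂, ← h, ha₁.reg r (by omega) (by omega)]
      ext n
      simp
  induction c with
  | zero =>
    intro s hs hreg hcr
    obtain ⟨s₁, h₁, hp₁, hcr₁, ha₁⟩ := once s hs hreg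
    obtain ⟨s₂, h₂, hp₂, hc₂, hr₂⟩ :=
      exists_reaches_loop_zero (s := s₁) (hp₁ ▸ hQ3) (by rw [hcr₁, hcr])
    exact ⟨s₂, h₁.trans h₂, by omega, ha₁.of_out (fun i _ => by rw [hc₂]) (fun i _ => by rw [hr₂])
      (by omega) fun h => by rw [hr₂]; exact h⟩
  | succ c ih =>
    intro s hs hreg hcr
    obtain ⟨s₁, h₁, hp₁, hcr₁, ha₁⟩ := once s hs hreg
    obtain ⟨s₂, h₂, hp₂, hcr₂, hc₂, hr₂⟩ :=
      exists_reaches_loop_succ (s := s₁) (hp₁ ▸ hQ3) (by rw [hcr₁, hcr])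
    have ha₂ := ha₁.of_out (t' := s₂) (fun i hi => hc₂ i (by omega)) (fun i _ => by rw [hr₂])
      (by omega) id
    obtain ⟨s₃, h₃, hp₃, ha₃⟩ := ih s₂ (by omega)
      (fun i hi hi' => (ha₂.reg i hi hi').trans (hreg i hi hi')) hcr₂
    refine ⟨s₃, (h₁.trans h₂).trans h₃, hp₃, (ha₂.trans ha₃ (by omega)).imp ?_⟩
    rintro ⟨⟨e₁, -⟩, e₂⟩
    rw [← hr₂] at e₁
    rwa [e₁, ← Function.iterate_succ_apply, ← Function.iterate_succ_apply] at e₂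

/-- Least and greatest fixpoints are treated at once: `T` is any set that equals every stable
iterate of the starting set, and `hstab` says that iterates are stable in late phases. -/
theorem exists_reaches_fixCode {r : ℕ} (hr : 2 ≤ r) {body : List Instr} {start : Bool}
    (s : Config G.Node) (F : Set G.Node → Set G.Node) (T : Set G.Node)
    (hQ : CodeAt Q s.pc (MuFormula.compile.fixCode r start body))
    (hbody : ∀ t : Config G.Node, t.pc = s.pc + 2 → (∀ i < r, 0 < i → t.reg i = s.reg i) →
      ∃ s', Reaches G Q t s' ∧ s'.pc = s.pc + 2 + body.length ∧
        t.Advances (r + 1) s' (s'.reg (r + 1) = F (t.reg r)))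
    (hstab : ∀ k, Fintype.card G.Node ≤ k →
      F^[k] {_n | start = true} = F^[k + 1] {_n | start = true})
    (hT : ∀ k, F^[k] {_n | start = true} = F^[k + 1] {_n | start = true} →
      T = F^[k] {_n | start = true}) :
    ∃ s', Reaches G Q s s' ∧ s'.pc = s.pc + (MuFormula.compile.fixCode r start body).length ∧
      s.Advances r s' (s'.reg r = T) := by
  obtain ⟨s₁, h₁, hp₁, hc₁, hd₁, hr₁⟩ := exists_reaches_op hQ (by omega)
  have hQ1 := hQ.tail
  rw [← hp₁] at hQ1
  obtain ⟨s₂, h₂, hp₂, hcr₂, hc₂, hr₂⟩ := exists_reaches_load hQ1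
  have hp₂' : s₂.pc = s.pc + 2 := by omega
  have ha₂ : s.Advances r s₂ True :=
    { cnt := fun i hi => by rw [hc₂ i (by omega), hc₁]
      reg := fun i hi _ => by rw [hr₂, hr₁ i (by omega)]
      ok_subset := by rw [hr₂, hr₁ 0 (by omega)]
      ok_eq := fun _ => by rw [hr₂, hr₁ 0 (by omega)]
      out := fun _ => trivial }
  have hQ2 := hQ1.tail
  rw [← hp₂, hp₂'] at hQ2
  obtain ⟨s₃, h₃, hp₃, ha₃⟩ := exists_reaches_loop hr s F hbody hQ2 (s.cnt 0) s₂ hp₂'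
    (fun i hi hi' => ha₂.reg i hi hi') (by rw [hcr₂, hc₁])
  have hQ5 := hQ2.right.tail.tail.tail
  have hp₃' : s₃.pc = s.pc + 2 + body.length + 1 + 1 + 1 := by omega
  rw [← hp₃'] at hQ5
  obtain ⟨s₄, h₄, hp₄, hc₄, hd₄, hr₄⟩ := exists_reaches_op hQ5 (by omega)
  have ha := (ha₂.trans ha₃ (by omega)).imp And.right
  rw [hr₂, hd₁] at ha
  have hok : s₄.reg 0 = s₃.reg 0 ∩ s₃.reg (r + 2) := by
    rw [hd₄]
    ext n
    simp
  refine ⟨s₄, ((h₁.trans h₂).trans h₃).trans h₄, ?_, ?_⟩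
  · simp [MuFormula.compile.fixCode]
    omega
  · refine ⟨fun i hi => by rw [hc₄, ha.cnt i hi],
      fun i hi hi' => by rw [hr₄ i (by omega), ha.reg i hi hi'], ?_, fun hk => ?_, fun ho => ?_⟩
    · rw [hok]
      exact Set.inter_subset_left.trans ha.ok_subset
    -- In a late phase the last two iterates agree, so the comparison register is full and the
    -- conjunction does not lower any flag.
    · rw [hok, (ha.out (Or.inr hk)).2, ← hstab _ hk, ha.ok_eq hk]
      simp
    -- A full register `0` after the conjunction was full before it, so all passes of the body were
    -- exact; the comparison register is full as well, so the iterate is stable.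
    · obtain ⟨e₁, e₂⟩ := ha.out (ho.imp_left fun hu => Set.univ_subset_iff.1 (by
        rw [← hu, hok]; exact Set.inter_subset_left))
      have e : F^[s.cnt 0] {_n | start = true} = F^[s.cnt 0 + 1] {_n | start = true} := by
        rcases ho with ho | hk
        · have hu : s₃.reg (r + 2) = Set.univ := Set.univ_subset_iff.1 (by
            rw [← ho, hok]; exact Set.inter_subset_right)
          rw [e₂] at hu
          ext n
          exact Set.eq_univ_iff_forall.1 hu n
        · exact hstab _ hk
      rw [hr₄ r (by omega), e₁, hT _ e, e]

end Correctness

open Classical in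
-- Induction on the formula. Subformula code touches only register `0` and the registers from its
-- own base upwards, so the propositions, the enclosing fixpoint variables and pending left operands
-- survive.
theorem MuFormula.exists_reaches_compile {P : Type v} {Var : Type w} {G : LabeledGraph.{u} (Set P)}
    {Q : List Instr} {π : P → ℕ} (φ : MuFormula P Var) :
    ∀ (ρ : Var → ℕ) (r : ℕ) (s : Config G.Node), 2 ≤ r → (∀ x, 0 < ρ x ∧ ρ x < r) →
      (∀ p, 0 < π p ∧ π p < r) → (∀ p, s.reg (π p) = {n | p ∈ G.label n}) →
      CodeAt Q s.pc (φ.compile π ρ r) →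
      ∃ s', Reaches G Q s s' ∧ s'.pc = s.pc + (φ.compile π ρ r).length ∧
        s.Advances r s' (s'.reg r = φ.sem G fun x => s.reg (ρ x)) := by
  have one : ∀ (r : ℕ) (s s' : Config G.Node) (p : Prop), s'.cnt = s.cnt → 2 ≤ r →
      (∀ i, i ≠ r → s'.reg i = s.reg i) → p → s.Advances r s' p := fun r s s' p hc hr h hp =>
    ⟨fun i _ => by rw [hc], fun i hi _ => h i (by omega), by rw [h 0 (by omega)],
      fun _ => h 0 (by omega), fun _ => hp⟩
  have rest : ∀ (r : ℕ) (s s' : Config G.Node) (p q : Prop), s.Advances r s' p → ∀ t, 2 ≤ r →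
      t.cnt = s'.cnt → (∀ i, i ≠ r → t.reg i = s'.reg i) → (p → q) → s.Advances r t q :=
    fun r s s' p q h t hr hc h' hpq => h.of_out (fun i _ => by rw [hc])
      (fun i hi => h' i (by omega)) (by omega) hpq
  have hup : ∀ (ρ : Var → ℕ) (x : Var) (r : ℕ), 2 ≤ r → (∀ y, 0 < ρ y ∧ ρ y < r) →
      ∀ y, 0 < Function.update ρ x r y ∧ Function.update ρ x r y < r + 1 := by
    intro ρ x r hr hρ y
    have := hρ y
    by_cases hy : y = x
    · subst hy
      rw [Function.update_self]
      omega
    · rw [Function.update_of_ne hy]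
      omega
  induction φ with
  | prop p =>
    intro ρ r s hr hρ hπ hprop hQ
    obtain ⟨s₁, h₁, hp₁, hc₁, hd₁, hr₁⟩ := exists_reaches_op hQ (by omega)
    refine ⟨s₁, h₁, hp₁, one r s s₁ _ hc₁ hr hr₁ ?_⟩
    rw [hd₁, hprop]
    ext n
    simp [sem]
  | negProp p =>
    intro ρ r s hr hρ hπ hprop hQ
    obtain ⟨s₁, h₁, hp₁, hc₁, hd₁, hr₁⟩ := exists_reaches_op hQ (by omega)
    refine ⟨s₁, h₁, hp₁, one r s s₁ _ hc₁ hr hr₁ ?_⟩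
    rw [hd₁, hprop]
    ext n
    simp [sem]
  | var x =>
    intro ρ r s hr hρ hπ hprop hQ
    obtain ⟨s₁, h₁, hp₁, hc₁, hd₁, hr₁⟩ := exists_reaches_op hQ (by omega)
    refine ⟨s₁, h₁, hp₁, one r s s₁ _ hc₁ hr hr₁ ?_⟩
    rw [hd₁]
    ext n
    simp [sem]
  | and φ ψ ih₁ ih₂ =>
    intro ρ r s hr hρ hπ hprop hQ
    obtain ⟨s₁, h₁, hp₁, ha₁⟩ := ih₁ ρ r s hr hρ hπ hprop hQ.left
    have hQ1 := hQ.right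
    rw [← hp₁] at hQ1
    obtain ⟨s₂, h₂, hp₂, ha₂⟩ := ih₂ ρ (r + 1) s₁ (by omega)
      (fun x => ⟨(hρ x).1, (hρ x).2.trans r.lt_succ_self⟩)
      (fun p => ⟨(hπ p).1, (hπ p).2.trans r.lt_succ_self⟩)
      (fun p => by rw [ha₁.reg _ (hπ p).2 (hπ p).1, hprop]) hQ1.left
    have hQ2 := hQ1.right
    rw [← hp₂] at hQ2
    obtain ⟨s₃, h₃, hp₃, hc₃, hd₃, hr₃⟩ := exists_reaches_op hQ2 (by omega)
    refine ⟨s₃, (h₁.trans h₂).trans h₃, by simp [compile]; omega,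
      rest r s s₂ _ _ (ha₁.trans (ha₂.mono r.le_succ) (by omega)) s₃ hr hc₃ hr₃ ?_⟩
    rintro ⟨e₁, e₂⟩
    simp only [fun x => ha₁.reg _ (hρ x).2 (hρ x).1] at e₂
    rw [hd₃, e₂, ha₂.reg r (by omega) (by omega), e₁]
    ext n
    simp [sem]
  | or φ ψ ih₁ ih₂ =>
    intro ρ r s hr hρ hπ hprop hQ
    obtain ⟨s₁, h₁, hp₁, ha₁⟩ := ih₁ ρ r s hr hρ hπ hprop hQ.left
    have hQ1 := hQ.right
    rw [← hp₁] at hQ1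
    obtain ⟨s₂, h₂, hp₂, ha₂⟩ := ih₂ ρ (r + 1) s₁ (by omega)
      (fun x => ⟨(hρ x).1, (hρ x).2.trans r.lt_succ_self⟩)
      (fun p => ⟨(hπ p).1, (hπ p).2.trans r.lt_succ_self⟩)
      (fun p => by rw [ha₁.reg _ (hπ p).2 (hπ p).1, hprop]) hQ1.left
    have hQ2 := hQ1.right
    rw [← hp₂] at hQ2
    obtain ⟨s₃, h₃, hp₃, hc₃, hd₃, hr₃⟩ := exists_reaches_op hQ2 (by omega)
    refine ⟨s₃, (h₁.trans h₂).trans h₃, by simp [compile]; omega,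
      rest r s s₂ _ _ (ha₁.trans (ha₂.mono r.le_succ) (by omega)) s₃ hr hc₃ hr₃ ?_⟩
    rintro ⟨e₁, e₂⟩
    simp only [fun x => ha₁.reg _ (hρ x).2 (hρ x).1] at e₂
    rw [hd₃, e₂, ha₂.reg r (by omega) (by omega), e₁]
    ext n
    simp [sem]
  | atLeast k φ ih =>
    intro ρ r s hr hρ hπ hprop hQ
    obtain ⟨s₁, h₁, hp₁, ha₁⟩ := ih ρ r s hr hρ hπ hprop hQ.left
    have hQ1 := hQ.right
    rw [← hp₁] at hQ1
    obtain ⟨s₂, h₂, hp₂, hc₂, hd₂, hr₂⟩ := exists_reaches_count hQ1 (by omega)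
    refine ⟨s₂, h₁.trans h₂, by simp [compile]; omega, rest r s s₁ _ _ ha₁ s₂ hr hc₂ hr₂ ?_⟩
    intro e
    rw [hd₂, e, sem]
    ext n
    rw [Set.mem_ofPred_eq, Set.mem_ofPred_eq, ← Set.ncard_coe_finset]
    simp [Set.inter_def]
  | allBut k φ ih =>
    intro ρ r s hr hρ hπ hprop hQ
    obtain ⟨s₁, h₁, hp₁, ha₁⟩ := ih ρ r s hr hρ hπ hprop hQ.left
    have hQ1 := hQ.right
    have hQ2 := hQ1.tail
    have hQ3 := hQ2.tail
    rw [← hp₁] at hQ1 hQ2 hQ3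
    obtain ⟨s₂, h₂, hp₂, hc₂, hd₂, hr₂⟩ := exists_reaches_op hQ1 (by omega)
    rw [← hp₂] at hQ2 hQ3
    obtain ⟨s₃, h₃, hp₃, hc₃, hd₃, hr₃⟩ := exists_reaches_count hQ2 (by omega)
    rw [← hp₃] at hQ3
    obtain ⟨s₄, h₄, hp₄, hc₄, hd₄, hr₄⟩ := exists_reaches_op hQ3 (by omega)
    refine ⟨s₄, ((h₁.trans h₂).trans h₃).trans h₄, by simp [compile]; omega,
      rest r s s₁ _ _ ha₁ s₄ hr (by rw [hc₄, hc₃, hc₂])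
        (fun i hi => by rw [hr₄ i hi, hr₃ i hi, hr₂ i hi]) ?_⟩
    intro e
    rw [hd₄, hd₃, hd₂, e, sem]
    ext n
    rw [Set.mem_ofPred_eq, Set.mem_ofPred_eq, Set.mem_ofPred_eq, ← Set.ncard_coe_finset]
    simp
    rfl
  | mu x φ ih =>
    intro ρ r s hr hρ hπ hprop hQ
    have hF : Monotone fun S => φ.sem G (Function.update (fun y => s.reg (ρ y)) x S) :=
      fun S T h => sem_mono G φ (Function.update_mono h)
    have e : {_n : G.Node | false = true} = ∅ := by simp
    refine exists_reaches_fixCode hr s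
      (fun S => φ.sem G (Function.update (fun y => s.reg (ρ y)) x S)) _ hQ
      (fun t ht hreg => ?_) (fun k hk => ?_) fun k hk => ?_
    · obtain ⟨s', h, hp, ha⟩ := ih (Function.update ρ x r) (r + 1) t (by omega) (hup ρ x r hr hρ)
        (fun p => ⟨(hπ p).1, (hπ p).2.trans r.lt_succ_self⟩)
        (fun p => by rw [hreg _ (hπ p).2 (hπ p).1, hprop]) (ht ▸ hQ.tail.tail.left)
      refine ⟨s', h, ht ▸ hp, ha.imp fun h => h.trans ?_⟩
      congr 1
      funext y
      by_cases hy : y = x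
      · subst hy
        simp
      · simp [Function.update_of_ne hy, hreg _ (hρ y).2 (hρ y).1]
    · rw [e]
      exact iterate_empty_eq_succ hF hk
    · rw [e] at hk ⊢
      exact sInter_eq_iterate hF hk
  | nu x φ ih =>
    intro ρ r s hr hρ hπ hprop hQ
    have hF : Monotone fun S => φ.sem G (Function.update (fun y => s.reg (ρ y)) x S) :=
      fun S T h => sem_mono G φ (Function.update_mono h)
    have e : {_n : G.Node | true = true} = Set.univ := by simp
    refine exists_reaches_fixCode hr s
      (fun S => φ.sem G (Function.update (fun y => s.reg (ρ y)) x S)) _ hQ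
      (fun t ht hreg => ?_) (fun k hk => ?_) fun k hk => ?_
    · obtain ⟨s', h, hp, ha⟩ := ih (Function.update ρ x r) (r + 1) t (by omega) (hup ρ x r hr hρ)
        (fun p => ⟨(hπ p).1, (hπ p).2.trans r.lt_succ_self⟩)
        (fun p => by rw [hreg _ (hπ p).2 (hπ p).1, hprop]) (ht ▸ hQ.tail.tail.left)
      refine ⟨s', h, ht ▸ hp, ha.imp fun h => h.trans ?_⟩
      congr 1
      funext y
      by_cases hy : y = x
      · subst hy
        simp
      · simp [Function.update_of_ne hy, hreg _ (hρ y).2 (hρ y).1]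
    · rw [e]
      exact iterate_univ_eq_succ hF hk
    · rw [e] at hk ⊢
      exact sUnion_eq_iterate hF hk

/-! ### Phases and halting -/

namespace MuFormula

section Phases

variable {P : Type v} {Var : Type w} {G : LabeledGraph.{u} (Set P)}

/-- The program of one phase of the evaluation of a sentence. Register `1` tells whether the node
agrees to halt; it is raised at the end of a phase only. -/
noncomputable def program (π : P → ℕ) (r : ℕ) (φ : MuFormula P Var) : List Instr :=
  .op 1 1 1 (fun _ _ => false) :: .op 0 0 0 (fun _ _ => true) ::
    -- A sentence has no free variables, so sending all of them to register `1` is a harmless dummy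
    -- choice.
    (φ.compile π (fun _ => 1) r ++ [.op 1 0 0 fun a _ => a])

/-- Register `1` is cleared by the first instruction and written again only by the last one, so the
run cannot stop inside a phase. Time `0` is excluded because the votes of the previous phase are
still present then. -/
theorem exists_phase_end {π : P → ℕ} {r : ℕ} (hr : 2 ≤ r) (hπ : ∀ p, 2 ≤ π p ∧ π p < r)
    {φ : MuFormula P Var} (hφ : φ.IsSentence) (s : Config G.Node) (hpc : s.pc = 0)
    (hprop : ∀ p, s.reg (π p) = {n | p ∈ G.label n}) :
    ∃ (n : ℕ) (t : Config G.Node), (machineStep G (φ.program π r))^[n] s = t ∧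
      t.pc = (φ.program π r).length ∧ t.cnt 0 = s.cnt 0 ∧
      (∀ i < n, 0 < i → ((machineStep G (φ.program π r))^[i] s).reg 1 = ∅) ∧
      (∀ p, t.reg (π p) = {n | p ∈ G.label n}) ∧
      (Fintype.card G.Node ≤ s.cnt 0 → t.reg 1 = Set.univ) ∧
      (t.reg 1 = Set.univ → t.reg r = φ.semSentence G) := by
  classical
  set Q := φ.program π r with hQdef
  have hQ : CodeAt Q s.pc Q := ⟨[], [], by simp, hpc.symm⟩
  have hstep₁ : machineStep G Q s = (Instr.op 1 1 1 fun _ _ => false).exec G s :=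
    CodeAt.step_eq G hQ
  set s₁ := machineStep G Q s with hs₁
  have hp₁ : s₁.pc = s.pc + 1 := by rw [hstep₁]; rfl
  have hc₁ : s₁.cnt = s.cnt := by rw [hstep₁]; rfl
  have hd₁ : s₁.reg 1 = ∅ := by
    rw [hstep₁]
    simp [Instr.exec]
  have hr₁ : ∀ i, i ≠ 1 → s₁.reg i = s.reg i := by
    intro i hi
    rw [hstep₁]
    exact Function.update_of_ne hi _ _
  have hQ1 := CodeAt.tail hQ
  rw [← hp₁] at hQ1
  obtain ⟨s₂, h₂, hp₂, hc₂, hd₂, hr₂⟩ := exists_reaches_op hQ1 (by omega)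
  have hd₂' : s₂.reg 0 = Set.univ := by
    rw [hd₂]
    simp
  have hQ2 := hQ1.tail
  rw [← hp₂] at hQ2
  obtain ⟨s₃, h₃, hp₃, ha⟩ := φ.exists_reaches_compile (fun _ => 1) r s₂ hr
    (fun _ => ⟨by omega, by omega⟩) (fun p => ⟨by have := hπ p; omega, (hπ p).2⟩)
    (fun p => by
      have := hπ p
      rw [hr₂ _ (by omega), hr₁ _ (by omega), hprop]) hQ2.left
  have hQ3 := hQ2.right
  rw [← hp₃] at hQ3
  have hstep₄ : machineStep G Q s₃ = (Instr.op 1 0 0 fun a _ => a).exec G s₃ :=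
    CodeAt.step_eq G hQ3
  set s₄ := machineStep G Q s₃ with hs₄
  have hd₄ : s₄.reg 1 = s₃.reg 0 := by
    rw [hstep₄]
    simp [Instr.exec]
  have hr₄ : ∀ i, i ≠ 1 → s₄.reg i = s₃.reg i := by
    intro i hi
    rw [hstep₄]
    exact Function.update_of_ne hi _ _
  obtain ⟨m, hm, hm1⟩ := h₂.trans h₃
  have hcnt : s₂.cnt 0 = s.cnt 0 := by rw [hc₂, hc₁]
  refine ⟨m + 1 + 1, s₄, ?_, ?_, ?_, ?_, ?_, ?_, ?_⟩
  · rw [Function.iterate_succ_apply', Function.iterate_succ_apply, ← hs₁, hm]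
  · have : s₄.pc = s₃.pc + 1 := by rw [hstep₄]; rfl
    rw [this, hp₃, hp₂, hp₁, hpc, hQdef, program]
    simp
    omega
  · have : s₄.cnt = s₃.cnt := by rw [hstep₄]; rfl
    rw [this, ha.cnt 0 (by omega), hcnt]
  · intro i hi hi'
    obtain ⟨j, rfl⟩ := Nat.exists_eq_add_of_le' hi'
    rw [Function.iterate_succ_apply, ← hs₁, hm1 j (by omega), hd₁]
  · intro p
    have := hπ p
    rw [hr₄ _ (by omega), ha.reg _ (by omega) (by omega), hr₂ _ (by omega), hr₁ _ (by omega),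
      hprop]
  · intro hk
    rw [hd₄, ha.ok_eq (by rwa [hcnt]), hd₂']
  · intro hu
    rw [hr₄ r (by omega), ha.out (Or.inl (hd₄ ▸ hu)), semSentence_eq hφ]

/-- Induction on a bound `j` for the number of phases until the phase number reaches the number of
nodes. After a failed phase, `restart` keeps the votes, which are not unanimous, so the first
unanimous vote ends the first successful phase. Without nodes the empty register `1` would already
be unanimous. -/
theorem exists_first_halt [Nonempty G.Node] {π : P → ℕ} {r : ℕ} (hr : 2 ≤ r)
    (hπ : ∀ p, 2 ≤ π p ∧ π p < r) {φ : MuFormula P Var} (hφ : φ.IsSentence) (j : ℕ) :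
    ∀ s : Config G.Node, Fintype.card G.Node ≤ s.cnt 0 + j → s.pc = 0 → s.reg 1 ≠ Set.univ →
      (∀ p, s.reg (π p) = {n | p ∈ G.label n}) →
      ∃ n, ((machineStep G (φ.program π r))^[n] s).reg 1 = Set.univ ∧
        (∀ i < n, ((machineStep G (φ.program π r))^[i] s).reg 1 ≠ Set.univ) ∧
        ((machineStep G (φ.program π r))^[n] s).reg r = φ.semSentence G := by
  have main : ∀ s : Config G.Node, s.pc = 0 → s.reg 1 ≠ Set.univ →
      (∀ p, s.reg (π p) = {n | p ∈ G.label n}) →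
      (¬ Fintype.card G.Node ≤ s.cnt 0 → ∀ t : Config G.Node, t.cnt 0 = s.cnt 0 + 1 → t.pc = 0 →
        t.reg 1 ≠ Set.univ → (∀ p, t.reg (π p) = {n | p ∈ G.label n}) →
        ∃ n, ((machineStep G (φ.program π r))^[n] t).reg 1 = Set.univ ∧
          (∀ i < n, ((machineStep G (φ.program π r))^[i] t).reg 1 ≠ Set.univ) ∧
          ((machineStep G (φ.program π r))^[n] t).reg r = φ.semSentence G) →
      ∃ n, ((machineStep G (φ.program π r))^[n] s).reg 1 = Set.univ ∧
        (∀ i < n, ((machineStep G (φ.program π r))^[i] s).reg 1 ≠ Set.univ) ∧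
        ((machineStep G (φ.program π r))^[n] s).reg r = φ.semSentence G := by
    intro s hpc h1 hprop hnext
    obtain ⟨n, t, rfl, htpc, htc, hbefore, htprop, hlate, hgood⟩ :=
      exists_phase_end hr hπ hφ s hpc hprop
    have hbefore' : ∀ i < n, ((machineStep G (φ.program π r))^[i] s).reg 1 ≠ Set.univ := by
      intro i hi
      rcases Nat.eq_zero_or_pos i with rfl | hi'
      · exact h1
      · rw [hbefore i hi hi']
        exact Set.empty_ne_univ
    by_cases hu : ((machineStep G (φ.program π r))^[n] s).reg 1 = Set.univ
    · exact ⟨n, hu, hbefore', hgood hu⟩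
    -- The program counter is just past the program, where the default instruction `restart` is
    -- fetched.
    · have hstep : (machineStep G (φ.program π r))^[n + 1] s =
          Instr.restart.exec G ((machineStep G (φ.program π r))^[n] s) := by
        rw [Function.iterate_succ_apply', machineStep, htpc]
        simp
      obtain ⟨m, hm1, hm2, hm3⟩ := hnext (fun hk => hu (hlate hk))
        ((machineStep G (φ.program π r))^[n + 1] s)
        (by rw [hstep]; simp [Instr.exec, htc]) (by rw [hstep]; rfl) (by rw [hstep]; exact hu)
        (by rw [hstep]; exact htprop)
      refine ⟨m + (n + 1), ?_, fun i hi => ?_, ?_⟩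
      · rwa [Function.iterate_add_apply]
      · rcases lt_trichotomy i n with hin | rfl | hin
        · exact hbefore' i hin
        · exact hu
        · obtain ⟨l, rfl⟩ := Nat.exists_eq_add_of_le' hin
          rw [Nat.succ_eq_add_one, Function.iterate_add_apply]
          exact hm2 l (by omega)
      · rwa [Function.iterate_add_apply]
  induction j with
  | zero => exact fun s hj hpc h1 hprop => main s hpc h1 hprop fun hk => absurd hj hk
  | succ j ih =>
    exact fun s hj hpc h1 hprop => main s hpc h1 hprop fun _ t ht => ih t (by omega)

end Phases

end MuFormula

/-! ### Simulating the machine by piecewise linear maps -/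

section Simulation

/-- Coordinates of a node state: program counter (one-hot), counters, registers. -/
abbrev Slot (L R : ℕ) : Type := Fin L ⊕ Fin R ⊕ Fin R

variable {L R : ℕ}

/-- Register `a` of a node state. -/
noncomputable def readReg (x : Slot L R → ℝ) (a : ℕ) : ℝ :=
  if h : a < R then x (.inr (.inr ⟨a, h⟩)) else 0

/-- Counter `c` of a node state. -/
noncomputable def readCnt (x : Slot L R → ℝ) (c : ℕ) : ℝ :=
  if h : c < R then x (.inr (.inl ⟨c, h⟩)) else 0

/-- A piecewise linear extension of a Boolean function. -/
noncomputable def extendBool (f : Bool → Bool → Bool) (a b : ℝ) : ℝ :=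
  -- On `{0, 1}²`, each of the four ReLU terms is the indicator of one corner.
  (f false false).toNat * max 0 (1 - (a + b)) + (f true true).toNat * max 0 (a + b - 1) +
    ((f true false).toNat * max 0 (a - b) + (f false true).toNat * max 0 (b - a))

/-- The effect of an instruction at position `p` on the state `x` of a node with sum `y` of the
states of its out-neighbours. -/
noncomputable def Instr.update (p : ℕ) (x y : Slot L R → ℝ) : Instr → Slot L R → ℝ
  | op _ _ _ _, .inl j => if p + 1 = j then 1 else 0
  | op _ _ _ _, .inr (.inl c) => x (.inr (.inl c))
  | op dst a b f, .inr (.inr i) =>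
    if (i : ℕ) = dst then extendBool f (readReg x a) (readReg x b) else x (.inr (.inr i))
  | count _ _ _, .inl j => if p + 1 = j then 1 else 0
  | count _ _ _, .inr (.inl c) => x (.inr (.inl c))
  | count dst a k, .inr (.inr i) =>
    if (i : ℕ) = dst then max 0 (readReg y a - (k - 1)) - max 0 (readReg y a - k)
    else x (.inr (.inr i))
  | load _, .inl j => if p + 1 = j then 1 else 0
  | load c, .inr (.inl c') => if (c' : ℕ) = c then readCnt x 0 else x (.inr (.inl c'))
  | load _, .inr (.inr i) => x (.inr (.inr i))
  | loop c back, .inl j => (if p + 1 = j then 1 else 0) * max 0 (2 * readCnt x c - 1) +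
      (if p - back = j then 1 else 0) * (1 - max 0 (2 * readCnt x c - 1))
  | loop c _, .inr (.inl c') =>
    -- Doubling `2⁻ᶜ` decrements the counter; the subtracted term equals `1` at `c = 0` and keeps
    -- the code at `1` there.
    if (c' : ℕ) = c then 2 * readCnt x c - max 0 (2 * readCnt x c - 1) else x (.inr (.inl c'))
  | loop _ _, .inr (.inr i) => x (.inr (.inr i))
  | restart, .inl j => if 0 = (j : ℕ) then 1 else 0
  | restart, .inr (.inl c') => if (c' : ℕ) = 0 then (1 / 2) * readCnt x 0 else x (.inr (.inl c'))
  | restart, .inr (.inr i) => x (.inr (.inr i))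

/-- The update of a node state in one step of the machine. -/
noncomputable def stateUpdate (Q : List Instr) (x y : Slot Q.length R → ℝ) (k : Slot Q.length R) :
    ℝ :=
  -- For `v ∈ [0, 1]`, `max 0 (x + v - 1)` is `v` if `x = 1` and `0` if `x = 0`, so only the current
  -- instruction contributes. The last summand takes over when no position in the program is active.
  (∑ p : Fin Q.length, max 0 (x (.inl p) + (Q[p].update p x y k - 1))) +
    max 0 (Instr.restart.update 0 x y k - ∑ p : Fin Q.length, x (.inl p))

open IsPiecewiseLinear in
theorem Instr.isPiecewiseLinear_update (i : Instr) (p : ℕ) (k : Slot L R) :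
    IsPiecewiseLinear fun z : Slot L R ⊕ Slot L R → ℝ =>
      i.update p (fun s => z (.inl s)) (fun s => z (.inr s)) k := by
  have reg : ∀ (e : Slot L R → Slot L R ⊕ Slot L R) a,
      IsPiecewiseLinear fun z : Slot L R ⊕ Slot L R → ℝ => readReg (fun s => z (e s)) a := by
    intro e a
    by_cases h : a < R
    · simpa only [readReg, h, dite_true] using coord _
    · simpa only [readReg, h, dite_false] using const 0
  have cnt : ∀ (e : Slot L R → Slot L R ⊕ Slot L R) a,
      IsPiecewiseLinear fun z : Slot L R ⊕ Slot L R → ℝ => readCnt (fun s => z (e s)) a := by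
    intro e a
    by_cases h : a < R
    · simpa only [readCnt, h, dite_true] using coord _
    · simpa only [readCnt, h, dite_false] using const 0
  have ite : ∀ (c : Prop) [Decidable c] (f g : (Slot L R ⊕ Slot L R → ℝ) → ℝ),
      IsPiecewiseLinear f → IsPiecewiseLinear g → IsPiecewiseLinear fun z =>
        if c then f z else g z := by
    intro c _ f g hf hg
    by_cases h : c
    · simpa only [h, if_true] using hf
    · simpa only [h, if_false] using hg
  rcases k with j | c | r <;> cases i <;> simp only [update, extendBool]
  all_goals first
    | exact const _
    | exact coord _
    | skip
  · exact ((((cnt _ _).smul 2).sub (const 1)).relu.smul _).add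
      (((const 1).sub (((cnt _ _).smul 2).sub (const 1)).relu).smul _)
  · exact ite _ _ _ (cnt _ _) (coord _)
  · exact ite _ _ _ (((cnt _ _).smul 2).sub (((cnt _ _).smul 2).sub (const 1)).relu) (coord _)
  · exact ite _ _ _ ((cnt _ _).smul _) (coord _)
  · exact ite _ _ _ (((((const 1).sub ((reg _ _).add (reg _ _))).relu.smul _).add
      ((((reg _ _).add (reg _ _)).sub (const 1)).relu.smul _)).add
      ((((reg _ _).sub (reg _ _)).relu.smul _).add (((reg _ _).sub (reg _ _)).relu.smul _)))
      (coord _)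
  · exact ite _ _ _ (((reg _ _).sub (const _)).relu.sub ((reg _ _).sub (const _)).relu) (coord _)

theorem isPiecewiseLinear_stateUpdate (Q : List Instr) (k : Slot Q.length R) :
    IsPiecewiseLinear fun z : Slot Q.length R ⊕ Slot Q.length R → ℝ =>
      stateUpdate Q (fun s => z (.inl s)) (fun s => z (.inr s)) k :=
  (IsPiecewiseLinear.sum _ fun p => ((IsPiecewiseLinear.coord _).add
    ((Q[p].isPiecewiseLinear_update p k).sub (.const 1))).relu).add
    ((Instr.restart.isPiecewiseLinear_update 0 k).sub
      (IsPiecewiseLinear.sum _ fun p => .coord _)).relu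

theorem IsPiecewiseLinear.comp_reindex {ι κ : Type} {f : (ι → ℝ) → ℝ} (hf : IsPiecewiseLinear f)
    (e : ι → κ) : IsPiecewiseLinear fun z : κ → ℝ => f fun i => z (e i) := by
  induction hf with
  | coord i => exact .coord _
  | const c => exact .const c
  | add _ _ h₁ h₂ => exact h₁.add h₂
  | smul c _ h => exact h.smul c
  | relu _ h => exact h.relu

section Encoding

variable {N : Type u}

open Classical in
/-- The real vector that represents the state of the node `n`. -/
noncomputable def Config.encode (s : Config N) (n : N) : Slot L R → ℝ
  | .inl j => if s.pc = j then 1 else 0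
  | .inr (.inl c) => (1 / 2) ^ s.cnt c
  | .inr (.inr i) => if n ∈ s.reg i then 1 else 0

theorem Config.encode_nonneg (s : Config N) (n : N) (k : Slot L R) : 0 ≤ s.encode n k := by
  rcases k with j | c | i <;> simp only [encode]
  · split_ifs <;> simp
  · positivity
  · split_ifs <;> simp

/-- This bound is why counters are stored as `2⁻ᶜ`: gating by the one-hot program counter works only
for values in `[0, 1]`. -/
theorem Config.encode_le_one (s : Config N) (n : N) (k : Slot L R) : s.encode n k ≤ 1 := by
  rcases k with j | c | i <;> simp only [encode]
  · split_ifs <;> simp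
  · exact pow_le_one₀ (by norm_num) (by norm_num)
  · split_ifs <;> simp

open Classical in
theorem Config.readReg_encode (s : Config N) (n : N) {a : ℕ} (h : a < R) :
    readReg (s.encode n : Slot L R → ℝ) a = if n ∈ s.reg a then 1 else 0 := by
  simp [readReg, h, encode]

theorem Config.readCnt_encode (s : Config N) (n : N) {a : ℕ} (h : a < R) :
    readCnt (s.encode n : Slot L R → ℝ) a = (1 / 2) ^ s.cnt a := by
  simp [readCnt, h, encode]

theorem relu_two_mul_half_pow (k : ℕ) :
    max (0 : ℝ) (2 * (1 / 2) ^ k - 1) = if k = 0 then 1 else 0 := by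
  rcases k with _ | k
  · norm_num
  · have : ((1 : ℝ) / 2) ^ k ≤ 1 := pow_le_one₀ (by norm_num) (by norm_num)
    rw [if_neg k.succ_ne_zero, pow_succ]
    exact max_eq_left (by linarith)

end Encoding

/-- All registers and counters used by the instruction are below `R`. -/
def Instr.Bounded (R : ℕ) : Instr → Prop
  | op dst a b _ => dst < R ∧ a < R ∧ b < R
  | count dst a _ => dst < R ∧ a < R
  | load c => c < R
  | loop c _ => c < R
  | restart => True

theorem Instr.Bounded.mono {R R' : ℕ} (h : R ≤ R') {i : Instr} (hi : i.Bounded R) :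
    i.Bounded R' := by
  cases i <;> simp only [Bounded] at * <;> omega

theorem exists_bounded (Q : List Instr) : ∃ R, ∀ i ∈ Q, i.Bounded R := by
  induction Q with
  | nil => exact ⟨0, by simp⟩
  | cons i Q ih =>
    obtain ⟨R, hR⟩ := ih
    obtain ⟨R', hi⟩ : ∃ R', i.Bounded R' := by
      cases i with
      | op dst a b f => exact ⟨dst + a + b + 1, by omega, by omega, by omega⟩
      | count dst a k => exact ⟨dst + a + 1, by omega, by omega⟩
      | load c => exact ⟨c + 1, by simp [Instr.Bounded]⟩
      | loop c b => exact ⟨c + 1, by simp [Instr.Bounded]⟩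
      | restart => exact ⟨0, trivial⟩
    refine ⟨max R R', fun j hj => ?_⟩
    rcases List.mem_cons.1 hj with rfl | hj
    · exact hi.mono (le_max_right _ _)
    · exact (hR j hj).mono (le_max_left _ _)

variable {X : Type v} (G : LabeledGraph.{u} X)

theorem extendBool_ite (f : Bool → Bool → Bool) (a b : Prop) [Decidable a] [Decidable b] :
    extendBool f (if a then 1 else 0) (if b then 1 else 0) =
      if f (decide a) (decide b) = true then 1 else 0 := by
  have key : ∀ c : Bool, (c.toNat : ℝ) = if c = true then 1 else 0 := by
    intro c
    cases c <;> simp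
  by_cases ha : a <;> by_cases hb : b <;> norm_num [ha, hb, extendBool, key]

theorem relu_sub_relu_natCast (m k : ℕ) :
    max (0 : ℝ) (m - (k - 1)) - max (0 : ℝ) (m - k) = if k ≤ m then 1 else 0 := by
  split_ifs with h
  · have : (k : ℝ) ≤ m := by exact_mod_cast h
    rw [max_eq_right (by linarith), max_eq_right (by linarith)]
    ring
  · have : (m : ℝ) + 1 ≤ k := by exact_mod_cast not_le.1 h
    rw [max_eq_left (by linarith), max_eq_left (by linarith)]
    ring

/-- Register coordinates are `0` or `1`, so their sum over the out-neighbours is a cardinality, and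
a difference of two ReLUs tests it against the threshold. -/
theorem Instr.update_encode {i : Instr} (hi : i.Bounded R) (hR : 0 < R) (s : Config G.Node)
    (n : G.Node) (p : ℕ) (k : Slot L R) :
    i.update p (s.encode n) (∑ m ∈ G.out n, s.encode m) k =
      (i.exec G ⟨p, s.cnt, s.reg⟩).encode n k := by
  classical
  cases i with
  | op dst a b f =>
    rcases k with j | c | r
    · rfl
    · rfl
    · by_cases h : (r : ℕ) = dst
      · simp only [update, h, if_true, exec, Config.encode, Function.update_self]
        rw [s.readReg_encode n hi.2.1, s.readReg_encode n hi.2.2, extendBool_ite]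
        simp
      · simp [update, h, exec, Config.encode]
  | count dst a k' =>
    rcases k with j | c | r
    · rfl
    · rfl
    · by_cases h : (r : ℕ) = dst
      · have e : readReg (∑ m ∈ G.out n, s.encode m : Slot L R → ℝ) a =
            (((G.out n).filter (· ∈ s.reg a)).card : ℕ) := by
          simp [readReg, hi.2, Config.encode]
        simp only [update, h, if_true, exec, Config.encode, Function.update_self]
        rw [e, relu_sub_relu_natCast]
        simp
      · simp [update, h, exec, Config.encode]
  | load c =>
    rcases k with j | c' | r
    · rfl
    · by_cases h : (c' : ℕ) = c
      · simp [update, h, exec, Config.encode, s.readCnt_encode n hR]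
      · simp [update, h, exec, Config.encode]
    · rfl
  | loop c back =>
    rcases k with j | c' | r
    · simp only [update, s.readCnt_encode n hi, relu_two_mul_half_pow, exec]
      split_ifs <;> simp_all [Config.encode]
    · by_cases h : (c' : ℕ) = c
      · simp only [update, s.readCnt_encode n hi, relu_two_mul_half_pow, exec, h, if_true]
        rcases hc : s.cnt c with _ | l
        · simp [Config.encode, h, hc]
          norm_num
        · simp [Config.encode, h, pow_succ]
          ring
      · by_cases hc : s.cnt c = 0 <;> simp [update, h, hc, exec, Config.encode]
    · by_cases hc : s.cnt c = 0 <;> simp [update, hc, exec, Config.encode]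
  | restart =>
    rcases k with j | c' | r
    · rfl
    · by_cases h : (c' : ℕ) = 0
      · simp [update, h, exec, Config.encode, s.readCnt_encode n hR, pow_succ]
        ring
      · simp [update, h, exec, Config.encode]
    · rfl

theorem stateUpdate_encode {Q : List Instr} (hQ : ∀ i ∈ Q, i.Bounded R) (hR : 0 < R)
    (s : Config G.Node) (n : G.Node) (k : Slot Q.length R) :
    stateUpdate Q (s.encode n) (∑ m ∈ G.out n, s.encode m) k =
      (machineStep G Q s).encode n k := by
  have hre := Instr.update_encode (L := Q.length) (i := .restart) G trivial hR s n 0 k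
  rw [stateUpdate, hre]
  have hle (t : Config G.Node) := t.encode_le_one n k
  have hge (t : Config G.Node) := t.encode_nonneg n k
  have hup (p : Fin Q.length) := Instr.update_encode (L := Q.length) G
    (hQ Q[p] (List.getElem_mem p.2)) hR s n p k
  simp only [hup, Config.encode.eq_1]
  by_cases h : s.pc < Q.length
  · have hs : machineStep G Q s = Q[s.pc].exec G s := by
      rw [machineStep, List.getD_eq_getElem _ _ h]
    have hne : ∀ p : Fin Q.length, p ≠ ⟨s.pc, h⟩ → s.pc ≠ p := fun p hp e => hp (Fin.ext e.symm)
    rw [Finset.sum_eq_single ⟨s.pc, h⟩, Finset.sum_eq_single ⟨s.pc, h⟩, if_pos rfl, hs,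
      max_eq_right, max_eq_left]
    · simp
    · linarith [hle (Instr.restart.exec G ⟨0, s.cnt, s.reg⟩)]
    · simpa using hge _
    · intro p _ hp
      rw [if_neg (hne p hp)]
    · simp
    · intro p _ hp
      rw [if_neg (hne p hp)]
      exact max_eq_left (by linarith [hle (Q[p].exec G ⟨p, s.cnt, s.reg⟩)])
    · simp
  · have hs : machineStep G Q s = Instr.restart.exec G s := by
      rw [machineStep, List.getD_eq_default _ _ (not_lt.1 h)]
    have hne : ∀ p : Fin Q.length, s.pc ≠ p := fun p e => h (e ▸ p.2)
    rw [Finset.sum_eq_zero, Finset.sum_eq_zero, hs, zero_add, sub_zero]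
    · exact max_eq_right (hge _)
    · intro p _
      rw [if_neg (hne p)]
    · intro p _
      rw [if_neg (hne p)]
      exact max_eq_left (by linarith [hle (Q[p].exec G ⟨p, s.cnt, s.reg⟩)])

end Simulation

/-! ### The network and the main theorem -/

/-- The state of the machine before the first step: the propositions are in their registers. -/
def Config.initial {P : Type v} (π : P → ℕ) (G : LabeledGraph.{u} (Set P)) : Config G.Node :=
  ⟨0, fun _ => 0, fun i => {n | ∃ p, π p = i ∧ p ∈ G.label n}⟩

open Classical in
/-- The node state that represents the initial configuration at a node with label `S`. -/
noncomputable def initialState {P : Type v} {L R : ℕ} (π : P → ℕ) (S : Set P) : Slot L R → ℝ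
  | .inl j => if 0 = (j : ℕ) then 1 else 0
  | .inr (.inl _) => 1
  | .inr (.inr i) => if ∃ p, π p = i ∧ p ∈ S then 1 else 0

/-- Every machine is simulated by a simple halting recurrent GNN, which halts and reads out by
given registers. -/
theorem exists_simple_gnn {P : Type v} (π : P → ℕ) {Q : List Instr} {R : ℕ}
    (hQ : ∀ i ∈ Q, i.Bounded R) {a b : ℕ} (ha : a < R) (hb : b < R) :
    ∃ (d : ℕ) (N : HaltingRecurrentGNN (Set P) d), N.IsSimple ∧
      ∀ (G : LabeledGraph.{u} (Set P)) (k : ℕ) (n : G.Node),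
        (N.hlt (N.run G k n) = true ↔
          n ∈ ((machineStep G Q)^[k] (Config.initial π G)).reg a) ∧
        (N.readout (N.run G k n) = true ↔
          n ∈ ((machineStep G Q)^[k] (Config.initial π G)).reg b) := by
  classical
  let e := Fintype.equivFin (Slot Q.length R)
  obtain ⟨F, hF⟩ := ReLUNetwork.exists_eval_eq
    (p := Fintype.card (Slot Q.length R) + Fintype.card (Slot Q.length R))
    (fun j z => stateUpdate Q (fun s => z (Fin.castAdd _ (e s))) (fun s => z (Fin.natAdd _ (e s)))
      (e.symm j))
    fun j => (isPiecewiseLinear_stateUpdate Q (e.symm j)).comp_reindex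
      (Sum.elim (fun s => Fin.castAdd _ (e s)) fun s => Fin.natAdd _ (e s))
  let N : HaltingRecurrentGNN (Set P) (Fintype.card (Slot Q.length R)) :=
    { init := fun S j => initialState π S (e.symm j)
      layer := ⟨_, Multiset.sum, fun x y => F.eval (Fin.append x y)⟩
      hlt := fun x => decide (0 < x (e (.inr (.inr ⟨a, ha⟩))))
      readout := fun x => decide (0 < x (e (.inr (.inr ⟨b, hb⟩)))) }
  refine ⟨_, N, ⟨⟨F, rfl⟩, ⟨_, fun x => by simp [N]; rfl⟩, ⟨_, fun x => by simp [N]; rfl⟩⟩, ?_⟩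
  intro G
  have hrun : ∀ k n, N.run G k n =
      fun j => ((machineStep G Q)^[k] (Config.initial π G)).encode n (e.symm j) := by
    intro k
    induction k with
    | zero =>
      intro n
      funext j
      simp only [HaltingRecurrentGNN.run, N, Function.iterate_zero, id]
      rcases e.symm j with j | c | i <;>
        simp [initialState, Config.encode, Config.initial] <;> congr
    | succ k ih =>
      intro n
      funext j
      have : N.run G (k + 1) n = F.eval (Fin.append (N.run G k n) (∑ m ∈ G.out n, N.run G k m)) :=
        rfl
      rw [this, hF, Function.iterate_succ_apply', ← stateUpdate_encode G hQ (by omega)]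
      congr 1
      · funext s
        rw [Fin.append_left]
        simp [ih]
      · funext s
        rw [Fin.append_right]
        simp [ih]
  intro k n
  constructor <;> simp only [N, hrun, Equiv.symm_apply_apply, Config.encode, decide_eq_true_eq] <;>
    split_ifs with h <;> simp [h]

theorem mainTheorem1 {P : Type v} [Finite P] {Var : Type w}
    (φ : MuFormula P Var) (C : NodeClassifier.{u} (Set P)) (hC : φ.Defines C) :
    ∃ (d : ℕ) (N : HaltingRecurrentGNN (Set P) d), N.IsSimple ∧ N.Defines C := by
  classical
  -- Registers `0` and `1` are reserved for the flag and the vote.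
  let π : P → ℕ := fun p => Finite.equivFin P p + 2
  have hinj : Function.Injective π := fun p q h =>
    (Finite.equivFin P).injective (Fin.ext (Nat.add_right_cancel h))
  let r := Nat.card P + 2
  have hπ : ∀ p, 2 ≤ π p ∧ π p < r := fun p =>
    ⟨Nat.le_add_left _ _, Nat.add_lt_add_right (Finite.equivFin P p).2 2⟩
  have hr : 2 ≤ r := Nat.le_add_left _ _
  obtain ⟨R, hR⟩ := exists_bounded (φ.program π r)
  obtain ⟨d, N, hN, hsim⟩ := exists_simple_gnn.{u} π (R := R + r + 1)
    (fun i hi => (hR i hi).mono (by omega)) (a := 1) (b := r) (by omega) (by omega)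
  have hhalt : ∀ (G : LabeledGraph.{u} (Set P)) k, N.AllHalt G k ↔
      ((machineStep G (φ.program π r))^[k] (Config.initial π G)).reg 1 = Set.univ := fun G k => by
    simp only [HaltingRecurrentGNN.AllHalt, hsim, Set.eq_univ_iff_forall]
  have hfirst : ∀ (G : LabeledGraph.{u} (Set P)) [Nonempty G.Node], ∃ k, N.IsComplete G k ∧
      ∀ n, N.readout (N.run G k n) = C G n := by
    intro G _
    obtain ⟨k, h1, h2, h3⟩ := MuFormula.exists_first_halt hr hπ hC.1 (Fintype.card G.Node)
      (Config.initial π G) (by omega) rfl (fun h => by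
        obtain ⟨n⟩ := ‹Nonempty G.Node›
        obtain ⟨p, hp, -⟩ := Set.eq_univ_iff_forall.1 h n
        have := hπ p
        omega) (fun p => by
          ext n
          exact ⟨fun ⟨q, hq, hn⟩ => hinj hq ▸ hn, fun hn => ⟨p, rfl, hn⟩⟩)
    refine ⟨k, ⟨(hhalt G k).2 h1, fun i hi h => h2 i hi ((hhalt G i).1 h)⟩, fun n => ?_⟩
    rw [Bool.eq_iff_iff, (hsim G k n).2, h3, hC.2 G]
    rfl
  refine ⟨d, N, hN, fun G => ?_, fun G k hk n => ?_⟩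
  · rcases isEmpty_or_nonempty G.Node with h | h
    -- On the empty graph the halting condition holds vacuously at time `0`.
    · exact ⟨0, fun n => isEmptyElim n, fun j hj => absurd hj j.not_lt_zero⟩
    · obtain ⟨k, hk, -⟩ := hfirst G
      exact ⟨k, hk⟩
  · have : Nonempty G.Node := ⟨n⟩
    obtain ⟨l, hl, hout⟩ := hfirst G
    obtain rfl : k = l := by
      rcases lt_trichotomy k l with h | h | h
      · exact absurd hk.1 (hl.2 k h)
      · exact h
      · exact absurd hl.1 (hk.2 l h)
    exact hout n
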